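/- Let $\Omega=C([0,\infty),\mathbb{R})$, $S_t(\omega)=\omega(t)$, and $\mathcal{F}_t=\sigma(S_s:s\le t)$. A simple strategy is $H_t=\sum_{k\ge 0}F_k\mathbf{1}_{(\tau_k,\tau_{k+1}]}(t)$ with $(\mathcal F_t)$-stopping times $0=\tau_0<\tau_1<\cdots$ with values in $[0,\infty]$ (strictly increasing as long as they are finite) such that on every path $\tau_k\le t$ for only finitely many $k$, for each $t<\infty$, and with bounded $\mathcal{F}_{\tau_k}$-measurable $F_k\colon\Omega\to\mathbb{R}$; its gains are $(H\cdot S)_t=\sum_{k\ge 0}F_k\,(S_{\tau_{k+1}\wedge t}-S_{\tau_k\wedge t})$. For $\lambda>0$ let $\mathcal{H}_\lambda$ be the set of simple strategies with $(H\cdot S)_t(\omega)\ge-\lambda$ for all $t\ge 0$ and $\omega\in\Omega$. For $A\subseteq\Omega$ let $$\overline{P}(A)=\inf\Big\{\lambda>0:\ \exists (H^n)_{n\in\mathbb N}\subseteq\mathcal{H}_\lambda\ \text{ with }\ \liminf_{t\to\infty}\liminf_{n\to\infty}\big(\lambda+(H^n\cdot S)_t(\omega)\big)\ge\mathbf{1}_A(\omega)\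 \ \forall\omega\in\Omega\Big\}.$$ A property holds for typical price paths if the set of $\omega$ where it fails has $\overline{P}$-measure $0$. For $n\in\mathbb{N}=\{0,1,2,\dots\}$ let $\mathbb{D}^n=\{m2^{-n}:m\in\mathbb{Z}\}$, and let $\pi^n=(\tau^n_k)_{k\ge 0}$ be the dyadic Lebesgue partition generated by $S$: $\tau^n_0=0$ and $\tau^n_{k+1}=\inf\{t\ge\tau^n_k: S_t\in\mathbb{D}^n\setminus\{S_{\tau^n_k}\}\}$ (with $\inf\emptyset=\infty$). Define the discrete local time $$L^{\pi^n}_t(u)=\sum_{k\ge 0}\mathbf{1}_{(\min(a_k,a_{k+1}),\,\max(a_k,a_{k+1})]}(u)\,|a_{k+1}-u|,\qquad a_k=S_{\tau^n_k\wedge t},\quad t\ge0,\ u\in\mathbb{R}.$$ **Theorem.** Let $T>0$ and $\alpha\in(0,1/2)$. For typical price paths there is a function $L\in C([0,T],C^\alpha(\mathbb{R}))$, where $C^\alpha(\mathbb{R})$ is the space of bounded $\alpha$-Hölder continuous functions with norm $\|f\|_\infty+\sup_{u\ne v}|f(u)-f(v)|/|u-v|^\alpha$, such that $L^{\pi^n}_t(u)\to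 L_t(u)$ uniformly in $(t,u)\in[0,T]\times\mathbb{R}$ as $n\to\infty$, and there is a constant $C>0$, depending on the path, such that $$\sup_{n\in\mathbb{N}}\ 2^{n\alpha}\sup_{(t,u)\in[0,T]\times\mathbb{R}}\big|L^{\pi^n}_t(u)-L_t(u)\big|\le C.$$ Moreover, for every $p>2$, for typical price paths $$\sup_{n\in\mathbb{N}}\ \sup_{t\in[0,T]}\ \sup\Big\{\Big(\sum_{k=1}^N|L^{\pi^n}_t(u_k)-L^{\pi^n}_t(u_{k-1})|^p\Big)^{1/p}:\ N\in\mathbb{N},\ u_0<\dots<u_N\Big\}<\infty.$$ -/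

import Mathlib

open MeasureTheory Filter Topology
open scoped NNReal ENNReal

namespace VovkLocalTime

noncomputable section

/-- The sample space `Ω = C([0,∞), ℝ)`. The coordinate process is `S_t(ω) = ω t`. -/
abbrev PricePath : Type := C(ℝ≥0, ℝ)

/-- The σ-algebra on `Ω` generated by all coordinates. -/
abbrev pathSigma : MeasurableSpace PricePath :=
  ⨆ s : ℝ≥0, MeasurableSpace.comap (fun ω : PricePath => ω s) (borel ℝ)

/-- The (raw) filtration `𝓕_t = σ(S_s : s ≤ t)` of the coordinate process. -/
def pathFiltration : Filtration ℝ≥0 pathSigma where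
  seq t := ⨆ s : ℝ≥0, ⨆ _ : s ≤ t,
    MeasurableSpace.comap (fun ω : PricePath => ω s) (borel ℝ)
  mono' _ _ hab := biSup_mono fun _ hs => le_trans hs hab
  le' _ := iSup₂_le fun s _ =>
    le_iSup (fun s : ℝ≥0 => MeasurableSpace.comap (fun ω : PricePath => ω s) (borel ℝ)) s

/-- The value `S_{τ ∧ t}` for a time `τ ∈ [0,∞]` and `t ∈ [0,∞)`. The minimum is finite, so
the default value of `untopA` plays no role. -/
def valueAtMin (S : PricePath) (τ : WithTop ℝ≥0) (t : ℝ≥0) : ℝ :=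
  S (min (t : WithTop ℝ≥0) τ).untopA

/-- A simple strategy `H = ∑ₖ Fₖ 1_{(τₖ, τₖ₊₁]}`: stopping times `0 = τ₀ < τ₁ < ⋯` with values
in `[0,∞]` (strictly increasing as long as they are finite), only finitely many of them below any
finite time on each path, and bounded `𝓕_{τₖ}`-measurable positions `Fₖ`. -/
structure SimpleStrategy where
  τ : ℕ → PricePath → WithTop ℝ≥0
  isStoppingTime : ∀ k, IsStoppingTime pathFiltration (τ k)
  τ_zero : ∀ ω, τ 0 ω = 0
  τ_mono : ∀ k ω, τ k ω ≤ τ (k + 1) ω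
  τ_strict : ∀ k ω, τ k ω ≠ ⊤ → τ k ω < τ (k + 1) ω
  τ_finite : ∀ (ω : PricePath) (T : ℝ≥0), {k : ℕ | τ k ω ≤ (T : WithTop ℝ≥0)}.Finite
  F : ℕ → PricePath → ℝ
  F_measurable : ∀ k, Measurable[(isStoppingTime k).measurableSpace] (F k)
  F_bounded : ∀ k, ∃ C : ℝ, ∀ ω, |F k ω| ≤ C

/-- The integral `(H · S)_t(ω) = ∑ₖ Fₖ(ω) (S_{τₖ₊₁ ∧ t}(ω) - S_{τₖ ∧ t}(ω))`. All terms with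
`τₖ(ω) ≥ t` vanish, so the sum has only finitely many nonzero terms. -/
def SimpleStrategy.integral (H : SimpleStrategy) (t : ℝ≥0) (ω : PricePath) : ℝ :=
  ∑' k : ℕ, H.F k ω * (valueAtMin ω (H.τ (k + 1) ω) t - valueAtMin ω (H.τ k ω) t)

/-- `lam`-admissibility: the gains never fall below `-lam`, on any path. -/
def SimpleStrategy.Admissible (H : SimpleStrategy) (lam : ℝ) : Prop :=
  ∀ (t : ℝ≥0) (ω : PricePath), -lam ≤ H.integral t ω

/-- The initial capital `lam` suffices to superhedge the indicator of `A` in the limit, along some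
sequence of `lam`-admissible simple strategies (the limits inferior are taken in `[-∞,∞]`). -/
def Superhedges (lam : ℝ) (A : Set PricePath) : Prop :=
  ∃ H : ℕ → SimpleStrategy, (∀ n, (H n).Admissible lam) ∧
    ∀ ω : PricePath,
      A.indicator (fun _ => (1 : EReal)) ω ≤
        liminf (fun t : ℝ≥0 =>
          liminf (fun n : ℕ => ((lam + (H n).integral t ω : ℝ) : EReal)) atTop) atTop

/-- The outer measure of `A`: the cheapest superhedging price of the indicator of `A`. -/
def outerMeasure (A : Set PricePath) : ℝ≥0∞ :=
  ⨅ (lam : ℝ) (_ : 0 < lam) (_ : Superhedges lam A), ENNReal.ofReal lam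

/-- A property holds for typical price paths if the set where it is violated is a null set. -/
def ForTypicalPaths (P : PricePath → Prop) : Prop :=
  outerMeasure {ω | ¬ P ω} = 0

/-- The dyadic grid `𝔻ⁿ = {m 2⁻ⁿ : m ∈ ℤ}`. -/
def dyadicGrid (n : ℕ) : Set ℝ :=
  {x | ∃ m : ℤ, x = (m : ℝ) * ((2 : ℝ) ^ n)⁻¹}

/-- The dyadic Lebesgue partition generated by the path `S`: `τⁿ₀ = 0` and
`τⁿₖ₊₁ = inf {t ≥ τⁿₖ : S_t ∈ 𝔻ⁿ \ {S_{τⁿₖ}}}`, with `inf ∅ = ∞`. If `τⁿₖ = ∞`, there is no finite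
`t ≥ τⁿₖ`, so also `τⁿₖ₊₁ = ∞`. -/
def lebesguePartition (S : PricePath) (n : ℕ) : ℕ → WithTop ℝ≥0
  | 0 => 0
  | k + 1 => sInf ((fun t : ℝ≥0 => (t : WithTop ℝ≥0)) ''
      {t : ℝ≥0 | lebesguePartition S n k ≤ (t : WithTop ℝ≥0) ∧
        S t ∈ dyadicGrid n \ {S (lebesguePartition S n k).untopA}})

/-- The discrete local time of `S` along the partition `π = {π 0 < π 1 < ⋯}` (times in `[0,∞]`),
`L^π_t(S,u) = ∑ⱼ 1_{⦅S_{tⱼ∧t}, S_{tⱼ₊₁∧t}⟧}(u) |S_{tⱼ₊₁∧t} - u|`, where `⦅a,b⟧ = (a ∧ b, a ∨ b]`.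
For a partition without finite accumulation points only finitely many terms are nonzero. -/
def discreteLocalTime (S : PricePath) (π : ℕ → WithTop ℝ≥0) (t : ℝ≥0) (u : ℝ) : ℝ :=
  ∑' j : ℕ, (Set.uIoc (valueAtMin S (π j) t) (valueAtMin S (π (j + 1)) t)).indicator
    (fun v => |valueAtMin S (π (j + 1)) t - v|) u

/-- The supremum norm on `[0,T] × ℝ`, with values in `[0,∞]`. -/
def supNorm (T : ℝ≥0) (f : ℝ≥0 → ℝ → ℝ) : ℝ≥0∞ :=
  ⨆ t ∈ Set.Icc 0 T, ⨆ u : ℝ, ‖f t u‖ₑ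

/-- The norm `‖f‖_∞ + [f]_α` of the Hölder space `C^α(ℝ)`, with values in `[0,∞]`. -/
def holderSpaceNorm (α : ℝ≥0) (f : ℝ → ℝ) : ℝ≥0∞ :=
  (⨆ u : ℝ, ‖f u‖ₑ) + eHolderNorm α f

/-- `L ∈ C([0,T], C^α(ℝ))`: every `L_t` lies in `C^α(ℝ)`, and `t ↦ L_t` is continuous on `[0,T]`
for the norm of `C^α(ℝ)`. -/
def IsContinuousIntoHolder (T α : ℝ≥0) (L : ℝ≥0 → ℝ → ℝ) : Prop :=
  (∀ t ∈ Set.Icc 0 T, holderSpaceNorm α (L t) < ∞) ∧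
    ∀ t ∈ Set.Icc 0 T,
      Tendsto (fun s : ℝ≥0 => holderSpaceNorm α (fun u => L s u - L t u))
        (𝓝[Set.Icc 0 T] t) (𝓝 0)

/-- The `p`-variation of `f : ℝ → ℝ` on the whole line, with values in `[0,∞]`. -/
def pVariation (p : ℝ) (f : ℝ → ℝ) : ℝ≥0∞ :=
  ⨆ (N : ℕ) (u : Fin (N + 1) → ℝ) (_ : StrictMono u),
    (∑ k : Fin N, ‖f (u k.succ) - f (u k.castSucc)‖ₑ ^ p) ^ (1 / p)

end

end VovkLocalTime

namespace VovkLocalTime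

noncomputable section

/-! The discrete Tanaka formula (`discreteLocalTime_eq`) writes the discrete local time as a
Lipschitz function of `u`, the same for all levels, plus `belowGain`: the gains of holding `1_{S <
u}` along the partition. Everything reduces to showing that `belowGain` at level `n` changes by only
about `n 2^{-n/2}` when the level is raised by one, or when `u` moves by one grid step.

The probabilistic input is one exponential inequality. For each level, grid point and sign, bet
multiplicatively on two kinds of positions: visits of the grid point, and the change of `1_{S < d}`
between consecutive levels. With capital split by summable weights, a typical path keeps all
weighted wealths bounded (`forTypicalPaths_bets_bounded`). Taking logarithms bounds every such gain
by `2^{-n/2}` times the logarithm of the inverse weight, linear in `n` on a bounded range, plus a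
quadratic variation term (`forTypicalPaths_localGain_le`). This is the only exceptional set; from
there on the argument is deterministic on a fixed path satisfying `LocalGainBound`.

The quadratic variations are numbers of visits of grid points. A Tanaka formula for `|x - d|` bounds
these by the supremum of `belowGain` at the same level (`visits_le`), so the estimates of
`exists_level_estimates` are implicit: their right side contains the quantity being bounded, but
with a factor summable in `n`. A discrete Gronwall argument closes them (`bddAbove_of_le_add_mul`,
`exists_uniform_estimates`).

The level increments then sum to a limit, at rate `2^{-nβ}` for every `β < 1/2`. Comparing `|u - v|`
with the dyadic scale makes the limit `β`-Hölder, and interpolation with uniform continuity in time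
gives continuity into `C^α`. For the `p`-variation take `β = 1/p`: the `p`-th powers of the
increments are dominated by those of a monotone function of bounded range. -/

/-! ### The dyadic Lebesgue partition of a path -/

/-- The value `S_{τⁿₖ}` of the path at a partition point (junk if `τⁿₖ = ∞`). -/
def skeleton (S : PricePath) (n k : ℕ) : ℝ := S (lebesguePartition S n k).untopA

/-- Multiplication by `2 ^ n` carries the grid onto the integers, all of whose subsets are closed in
the reals. The point is the grid with one value removed, the target set of a partition step. -/
theorem isClosed_of_subset_dyadicGrid {n : ℕ} {s : Set ℝ} (hs : s ⊆ dyadicGrid n) :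
    IsClosed s := by
  have hpos : (0 : ℝ) < 2 ^ n := by positivity
  have h : s = (fun x : ℝ => x * 2 ^ n) ⁻¹'
      ((Int.cast : ℤ → ℝ) '' {m : ℤ | (m : ℝ) * ((2 : ℝ) ^ n)⁻¹ ∈ s}) := by
    ext x
    constructor
    · intro hx
      obtain ⟨m, hm⟩ := hs hx
      refine ⟨m, ?_, ?_⟩
      · rw [hm] at hx; exact hx
      · rw [hm]; field_simp
    · rintro ⟨m, hm, hmx⟩
      have : x = (m : ℝ) * ((2 : ℝ) ^ n)⁻¹ := by rw [hmx]; field_simp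
      rw [this]; exact hm
  rw [h]
  exact (Int.isClosedEmbedding_coe_real.isClosedMap _ (isClosed_discrete _)).preimage
    (by fun_prop)

theorem dyadicGrid_mono {m n : ℕ} (h : m ≤ n) : dyadicGrid m ⊆ dyadicGrid n := by
  rintro x ⟨k, rfl⟩
  refine ⟨k * 2 ^ (n - m), ?_⟩
  have : (2 : ℝ) ^ n = 2 ^ m * 2 ^ (n - m) := by rw [← pow_add]; congr 1; omega
  rw [this]; push_cast; field_simp

theorem countable_dyadicGrid (n : ℕ) : (dyadicGrid n).Countable := by
  have : dyadicGrid n = Set.range fun m : ℤ => (m : ℝ) * ((2 : ℝ) ^ n)⁻¹ := by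
    ext x; simp [dyadicGrid, eq_comm]
  rw [this]; exact Set.countable_range _

theorem le_abs_sub_of_mem_dyadicGrid {n : ℕ} {x y : ℝ} (hx : x ∈ dyadicGrid n)
    (hy : y ∈ dyadicGrid n) (hxy : x ≠ y) : ((2 : ℝ) ^ n)⁻¹ ≤ |x - y| := by
  obtain ⟨k, rfl⟩ := hx
  obtain ⟨l, rfl⟩ := hy
  have hkl : k ≠ l := fun h => hxy (by rw [h])
  rw [← sub_mul, abs_mul, abs_of_pos (a := ((2 : ℝ) ^ n)⁻¹) (by positivity)]
  have : (1 : ℝ) ≤ |(k : ℝ) - l| := by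
    exact_mod_cast Int.one_le_abs (sub_ne_zero.2 hkl)
  exact le_mul_of_one_le_left (by positivity) this

/-- The target set is closed and the path continuous, so the infimum is attained whenever the set of
hitting times is nonempty. Later arguments use this in place of the definition by `sInf`. -/
theorem lebesguePartition_succ_le_iff (S : PricePath) (n k : ℕ) (t : ℝ≥0) :
    lebesguePartition S n (k + 1) ≤ (t : WithTop ℝ≥0) ↔
      ∃ s ≤ t, lebesguePartition S n k ≤ (s : WithTop ℝ≥0) ∧
        S s ∈ dyadicGrid n \ {skeleton S n k} := by
  set A : Set ℝ≥0 := {t : ℝ≥0 | lebesguePartition S n k ≤ (t : WithTop ℝ≥0) ∧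
        S t ∈ dyadicGrid n \ {skeleton S n k}} with hA
  have hdef : lebesguePartition S n (k + 1) = sInf ((fun t : ℝ≥0 => (t : WithTop ℝ≥0)) '' A) := rfl
  have hclosed : IsClosed A := by
    by_cases hτ : lebesguePartition S n k = ⊤
    · have : A = ∅ := by
        ext x
        simp only [hA, hτ, Set.mem_ofPred_eq, Set.mem_empty_iff_false, iff_false, not_and]
        exact fun h => absurd (top_le_iff.1 h) WithTop.coe_ne_top
      rw [this]; exact isClosed_empty
    · obtain ⟨r, hr⟩ := WithTop.ne_top_iff_exists.1 hτ
      have : A = Set.Ici r ∩ S ⁻¹' (dyadicGrid n \ {skeleton S n k}) := by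
        ext x
        simp only [hA, ← hr, Set.mem_ofPred_eq, WithTop.coe_le_coe]
        rfl
      rw [this]
      exact isClosed_Ici.inter
        ((isClosed_of_subset_dyadicGrid Set.sdiff_subset).preimage S.continuous)
  rcases A.eq_empty_or_nonempty with h | h
  · rw [hdef, h]
    constructor
    · intro h'
      rw [Set.image_empty, WithTop.sInf_empty] at h'
      exact absurd (top_le_iff.1 h') WithTop.coe_ne_top
    · rintro ⟨s, -, hs⟩
      have : s ∈ A := hs
      rw [h] at this; exact this.elim
  · rw [hdef, ← WithTop.coe_sInf' h (OrderBot.bddBelow A), WithTop.coe_le_coe]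
    constructor
    · intro h'
      exact ⟨sInf A, h', hclosed.csInf_mem h (OrderBot.bddBelow A)⟩
    · rintro ⟨s, hst, hs⟩
      exact (csInf_le (OrderBot.bddBelow A) hs).trans hst

theorem lebesguePartition_zero (S : PricePath) (n : ℕ) : lebesguePartition S n 0 = 0 := rfl

theorem skeleton_zero (S : PricePath) (n : ℕ) : skeleton S n 0 = S 0 := rfl

/-- A finite partition point is attained. -/
theorem mem_of_lebesguePartition_succ_eq {S : PricePath} {n k : ℕ} {t : ℝ≥0}
    (h : lebesguePartition S n (k + 1) = t) :
    lebesguePartition S n k ≤ (t : WithTop ℝ≥0) ∧ S t ∈ dyadicGrid n \ {skeleton S n k} := by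
  obtain ⟨s, hst, hs⟩ := (lebesguePartition_succ_le_iff S n k t).1 h.le
  have h1 : lebesguePartition S n (k + 1) ≤ (s : WithTop ℝ≥0) :=
    (lebesguePartition_succ_le_iff S n k s).2 ⟨s, le_rfl, hs⟩
  rw [h, WithTop.coe_le_coe] at h1
  rwa [le_antisymm hst h1] at hs

theorem skeleton_eq {S : PricePath} {n k : ℕ} {t : ℝ≥0} (h : lebesguePartition S n k = t) :
    skeleton S n k = S t := by
  rw [skeleton, h]; rfl

theorem lebesguePartition_le_succ (S : PricePath) (n k : ℕ) :
    lebesguePartition S n k ≤ lebesguePartition S n (k + 1) := by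
  rcases h : lebesguePartition S n (k + 1) with _ | t
  · exact le_top
  · exact (mem_of_lebesguePartition_succ_eq h).1

theorem lebesguePartition_mono (S : PricePath) (n : ℕ) : Monotone (lebesguePartition S n) :=
  monotone_nat_of_le_succ (lebesguePartition_le_succ S n)

theorem skeleton_succ_ne {S : PricePath} {n k : ℕ} (h : lebesguePartition S n (k + 1) ≠ ⊤) :
    skeleton S n (k + 1) ≠ skeleton S n k := by
  obtain ⟨t, ht⟩ := WithTop.ne_top_iff_exists.1 h
  rw [skeleton_eq ht.symm]
  exact (mem_of_lebesguePartition_succ_eq ht.symm).2.2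

theorem skeleton_succ_mem {S : PricePath} {n k : ℕ} (h : lebesguePartition S n (k + 1) ≠ ⊤) :
    skeleton S n (k + 1) ∈ dyadicGrid n := by
  obtain ⟨t, ht⟩ := WithTop.ne_top_iff_exists.1 h
  rw [skeleton_eq ht.symm]
  exact (mem_of_lebesguePartition_succ_eq ht.symm).2.1

theorem lebesguePartition_lt_succ (S : PricePath) (n k : ℕ) (h : lebesguePartition S n k ≠ ⊤) :
    lebesguePartition S n k < lebesguePartition S n (k + 1) := by
  refine lt_of_le_of_ne (lebesguePartition_le_succ S n k) fun heq => ?_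
  refine skeleton_succ_ne (S := S) (n := n) (k := k) (heq ▸ h) ?_
  rw [skeleton, skeleton, heq]

/-- Between consecutive partition points the path moves by at most `2⁻ⁿ`. -/
theorem abs_sub_skeleton_le {S : PricePath} {n k : ℕ} {t : ℝ≥0}
    (h₁ : lebesguePartition S n k ≤ (t : WithTop ℝ≥0))
    (h₂ : (t : WithTop ℝ≥0) ≤ lebesguePartition S n (k + 1)) :
    |S t - skeleton S n k| ≤ ((2 : ℝ) ^ n)⁻¹ := by
  obtain ⟨r, hr⟩ := WithTop.ne_top_iff_exists.1 (ne_top_of_le_ne_top WithTop.coe_ne_top h₁)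
  rw [← hr, WithTop.coe_le_coe] at h₁
  have hc := skeleton_eq hr.symm
  have hpos : (0 : ℝ) < 2 ^ n := by positivity
  -- A grid value other than the starting one, taken in `[r, t]`, ends the interval; as `t` is at
  -- most the end, it can only be taken at `t` itself.
  have key : ∀ d ∈ dyadicGrid n, d ≠ skeleton S n k → d ∈ S '' Set.Icc r t → S t = d := by
    rintro d hd hne ⟨s, ⟨hrs, hst⟩, rfl⟩
    have : lebesguePartition S n (k + 1) ≤ (s : WithTop ℝ≥0) :=
      (lebesguePartition_succ_le_iff S n k s).2
        ⟨s, le_rfl, by rw [← hr]; exact WithTop.coe_le_coe.2 hrs, hd, hne⟩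
    have := WithTop.coe_le_coe.1 (h₂.trans this)
    rw [le_antisymm hst this]
  have hcont : ContinuousOn S (Set.Icc r t) := S.continuous.continuousOn
  rw [abs_le]
  constructor
  · by_contra hlt
    push Not at hlt
    set c := skeleton S n k
    -- The nearest grid point strictly below `c`. For `k = 0` the value `c` is `S 0`, which need not
    -- lie on the grid, hence the rounding.
    have hd : ((⌈c * 2 ^ n⌉ - 1 : ℤ) : ℝ) * ((2 : ℝ) ^ n)⁻¹ < c := by
      rw [← div_eq_mul_inv, div_lt_iff₀ hpos]; push_cast
      linarith [Int.ceil_lt_add_one (c * 2 ^ n)]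
    have hd' : c - ((2 : ℝ) ^ n)⁻¹ ≤ ((⌈c * 2 ^ n⌉ - 1 : ℤ) : ℝ) * ((2 : ℝ) ^ n)⁻¹ := by
      have h3 := Int.le_ceil (c * 2 ^ n)
      rw [← div_eq_mul_inv, le_div_iff₀ hpos, sub_mul, inv_mul_cancel₀ hpos.ne']
      push_cast
      linarith
    have := key _ ⟨_, rfl⟩ hd.ne
      (intermediate_value_Icc' h₁ hcont ⟨by linarith, by rw [← hc]; exact hd.le⟩)
    linarith
  · by_contra hlt
    push Not at hlt
    set c := skeleton S n k
    have hd : c < ((⌊c * 2 ^ n⌋ + 1 : ℤ) : ℝ) * ((2 : ℝ) ^ n)⁻¹ := by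
      rw [← div_eq_mul_inv, lt_div_iff₀ hpos]; push_cast
      linarith [Int.lt_floor_add_one (c * 2 ^ n)]
    have hd' : ((⌊c * 2 ^ n⌋ + 1 : ℤ) : ℝ) * ((2 : ℝ) ^ n)⁻¹ ≤ c + ((2 : ℝ) ^ n)⁻¹ := by
      have h3 := Int.floor_le (c * 2 ^ n)
      rw [← div_eq_mul_inv, div_le_iff₀ hpos, add_mul, inv_mul_cancel₀ hpos.ne']
      push_cast
      linarith
    have := key _ ⟨_, rfl⟩ hd.ne'
      (intermediate_value_Icc h₁ hcont ⟨by rw [← hc]; exact hd.le, by linarith⟩)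
    linarith

theorem finite_lebesguePartition_le (S : PricePath) (n : ℕ) (T : ℝ≥0) :
    {k : ℕ | lebesguePartition S n k ≤ (T : WithTop ℝ≥0)}.Finite := by
  by_contra hinf
  have hall : ∀ k, lebesguePartition S n k ≤ (T : WithTop ℝ≥0) := by
    intro k
    obtain ⟨l, hl, hkl⟩ := Set.Infinite.exists_gt hinf k
    exact (lebesguePartition_mono S n hkl.le).trans hl
  have hne : ∀ k, lebesguePartition S n k ≠ ⊤ := fun k =>
    ne_top_of_le_ne_top WithTop.coe_ne_top (hall k)
  set σ : ℕ → ℝ≥0 := fun k => (lebesguePartition S n k).untopA with hσ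
  have hcoe : ∀ k, (σ k : WithTop ℝ≥0) = lebesguePartition S n k := fun k => by
      obtain ⟨t, ht⟩ := WithTop.ne_top_iff_exists.1 (hne k)
      simp only [hσ, ← ht]
      rfl
  have hmono : Monotone σ := fun a b hab => by
    rw [← WithTop.coe_le_coe, hcoe, hcoe]; exact lebesguePartition_mono S n hab
  have hbdd : BddAbove (Set.range σ) := ⟨T, by
    rintro _ ⟨k, rfl⟩
    rw [← WithTop.coe_le_coe, hcoe]; exact hall k⟩
  have hlim := tendsto_atTop_ciSup hmono hbdd
  have h1 : Tendsto (fun k => S (σ k)) atTop (𝓝 (S (⨆ k, σ k))) :=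
    (S.continuous.tendsto _).comp hlim
  -- Infinitely many partition points before `T` would accumulate, forcing the increments to zero,
  -- although grid points are `2⁻ⁿ` apart. The shift by one skips `S 0`, which may be off the grid.
  have h2 : Tendsto (fun k => |S (σ (k + 1 + 1)) - S (σ (k + 1))|) atTop (𝓝 0) := by
    have h3 := ((h1.comp (tendsto_add_atTop_nat 2)).sub (h1.comp (tendsto_add_atTop_nat 1))).abs
    simpa using h3
  have hpos : (0 : ℝ) < ((2 : ℝ) ^ n)⁻¹ := by positivity
  obtain ⟨k, hk⟩ := (h2.eventually (gt_mem_nhds hpos)).exists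
  exact absurd hk (not_lt.2 (le_abs_sub_of_mem_dyadicGrid (skeleton_succ_mem (hne _))
    (skeleton_succ_mem (hne _)) (skeleton_succ_ne (hne _))))

/-! ### Gains along the dyadic Lebesgue partition -/

theorem valueAtMin_of_le {S : PricePath} {τ : WithTop ℝ≥0} {t : ℝ≥0}
    (h : τ ≤ (t : WithTop ℝ≥0)) : valueAtMin S τ t = S τ.untopA := by
  rw [valueAtMin, min_eq_right h]

theorem valueAtMin_of_ge {S : PricePath} {τ : WithTop ℝ≥0} {t : ℝ≥0}
    (h : (t : WithTop ℝ≥0) ≤ τ) : valueAtMin S τ t = S t := by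
  rw [valueAtMin, min_eq_left h]; rfl

theorem exists_lebesguePartition_le_lt (S : PricePath) (n : ℕ) (t : ℝ≥0) :
    ∃ J, lebesguePartition S n J ≤ (t : WithTop ℝ≥0) ∧
      (t : WithTop ℝ≥0) < lebesguePartition S n (J + 1) := by
  have hex : ∃ k, (t : WithTop ℝ≥0) < lebesguePartition S n k := by
    by_contra hcon
    push Not at hcon
    refine Set.infinite_univ (α := ℕ) ?_
    convert! finite_lebesguePartition_le S n t
    exact (Set.eq_univ_of_forall hcon).symm
  classical
  have h0 : Nat.find hex ≠ 0 := fun h => by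
    have := Nat.find_spec hex
    rw [h, lebesguePartition_zero] at this
    exact absurd this (not_lt.2 bot_le)
  obtain ⟨J, hJ⟩ := Nat.exists_eq_succ_of_ne_zero h0
  exact ⟨J, not_lt.1 (Nat.find_min hex (by omega)), by
    have := Nat.find_spec hex
    rwa [hJ] at this⟩

/-- The gains up to time `t` of holding the position `F k` on the `k`-th interval of the dyadic
Lebesgue partition of level `n`. -/
def levelGain (S : PricePath) (n : ℕ) (F : ℕ → ℝ) (t : ℝ≥0) : ℝ :=
  ∑' k : ℕ, F k * (valueAtMin S (lebesguePartition S n (k + 1)) t -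
    valueAtMin S (lebesguePartition S n k) t)

theorem tsum_partition_eq_sum {S : PricePath} {n J : ℕ} {t : ℝ≥0}
    (h₂ : (t : WithTop ℝ≥0) ≤ lebesguePartition S n (J + 1))
    (f : ℕ → ℝ → ℝ → ℝ) (hf : ∀ k x, f k x x = 0) :
    ∑' k : ℕ, f k (valueAtMin S (lebesguePartition S n k) t)
      (valueAtMin S (lebesguePartition S n (k + 1)) t) =
    ∑ k ∈ Finset.range (J + 1), f k (valueAtMin S (lebesguePartition S n k) t)
      (valueAtMin S (lebesguePartition S n (k + 1)) t) := by
  refine tsum_eq_sum fun k hk => ?_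
  have hJk : J + 1 ≤ k := by simpa using hk
  have h3 := h₂.trans (lebesguePartition_mono S n hJk)
  rw [valueAtMin_of_ge h3, valueAtMin_of_ge (h3.trans (lebesguePartition_le_succ S n k)), hf]

/-- With `J` the interval containing `t`, earlier intervals are complete, the `J`-th is cut off at
`t`, and later ones are degenerate. The general summand serves both gains and local times. -/
theorem tsum_partition_eq {S : PricePath} {n J : ℕ} {t : ℝ≥0}
    (h₁ : lebesguePartition S n J ≤ (t : WithTop ℝ≥0))
    (h₂ : (t : WithTop ℝ≥0) ≤ lebesguePartition S n (J + 1))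
    (f : ℕ → ℝ → ℝ → ℝ) (hf : ∀ k x, f k x x = 0) :
    ∑' k : ℕ, f k (valueAtMin S (lebesguePartition S n k) t)
      (valueAtMin S (lebesguePartition S n (k + 1)) t) =
    ∑ k ∈ Finset.range J, f k (skeleton S n k) (skeleton S n (k + 1)) +
      f J (skeleton S n J) (S t) := by
  rw [tsum_partition_eq_sum h₂ f hf, Finset.sum_range_succ, valueAtMin_of_ge h₂,
    valueAtMin_of_le h₁]
  congr 1
  refine Finset.sum_congr rfl fun k hk => ?_
  have hk : k + 1 ≤ J := by simpa using hk
  rw [valueAtMin_of_le ((lebesguePartition_mono S n hk).trans h₁),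
    valueAtMin_of_le ((lebesguePartition_mono S n (by omega : k ≤ J)).trans h₁)]
  rfl

theorem levelGain_eq {S : PricePath} {n J : ℕ} {t : ℝ≥0}
    (h₁ : lebesguePartition S n J ≤ (t : WithTop ℝ≥0))
    (h₂ : (t : WithTop ℝ≥0) ≤ lebesguePartition S n (J + 1)) (F : ℕ → ℝ) :
    levelGain S n F t =
      ∑ k ∈ Finset.range J, F k * (skeleton S n (k + 1) - skeleton S n k) +
        F J * (S t - skeleton S n J) :=
  tsum_partition_eq h₁ h₂ (fun k x y => F k * (y - x)) (by simp)

theorem levelGain_add (S : PricePath) (n : ℕ) (F G : ℕ → ℝ) (t : ℝ≥0) :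
    levelGain S n (F + G) t = levelGain S n F t + levelGain S n G t := by
  obtain ⟨J, h₁, h₂⟩ := exists_lebesguePartition_le_lt S n t
  simp only [levelGain_eq h₁ h₂.le, Pi.add_apply, add_mul, Finset.sum_add_distrib]
  ring

theorem levelGain_smul (S : PricePath) (n : ℕ) (c : ℝ) (F : ℕ → ℝ) (t : ℝ≥0) :
    levelGain S n (c • F) t = c * levelGain S n F t := by
  obtain ⟨J, h₁, h₂⟩ := exists_lebesguePartition_le_lt S n t
  simp only [levelGain_eq h₁ h₂.le, Pi.smul_apply, smul_eq_mul, mul_add, Finset.mul_sum, mul_assoc]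

theorem levelGain_sub (S : PricePath) (n : ℕ) (F G : ℕ → ℝ) (t : ℝ≥0) :
    levelGain S n (F - G) t = levelGain S n F t - levelGain S n G t := by
  have h : F - G = F + (-1 : ℝ) • G := by ext; simp [sub_eq_add_neg]
  rw [h, levelGain_add, levelGain_smul]; ring

/-- The index of the interval of the partition of level `n` that contains the `l`-th point of the
finer partition of level `N`. -/
def coarseIndex (S : PricePath) (n N : ℕ) : ℕ → ℕ
  | 0 => 0
  | l + 1 => if lebesguePartition S n (coarseIndex S n N l + 1) ≤ lebesguePartition S N (l + 1)
      then coarseIndex S n N l + 1 else coarseIndex S n N l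

theorem coarseIndex_le (S : PricePath) (n N l : ℕ) : coarseIndex S n N l ≤ l := by
  induction l with
  | zero => exact le_rfl
  | succ l ih => rw [coarseIndex]; split_ifs <;> omega

/-- The finer partition visits every point of the coarser one. -/
theorem lebesguePartition_succ_le_of_lt {S : PricePath} {n N j l : ℕ} (hnN : n ≤ N)
    (h₁ : lebesguePartition S n j ≤ lebesguePartition S N l)
    (h₂ : lebesguePartition S N l < lebesguePartition S n (j + 1)) :
    lebesguePartition S N (l + 1) ≤ lebesguePartition S n (j + 1) := by
  by_cases htop : lebesguePartition S n (j + 1) = ⊤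
  · rw [htop]; exact le_top
  obtain ⟨s, hs⟩ := WithTop.ne_top_iff_exists.1 htop
  obtain ⟨r, hr⟩ := WithTop.ne_top_iff_exists.1 h₂.ne_top
  obtain ⟨-, h3, h4⟩ := mem_of_lebesguePartition_succ_eq hs.symm
  rw [← hs]
  refine (lebesguePartition_succ_le_iff S N l s).2
    ⟨s, le_rfl, h₂.le.trans hs.ge, dyadicGrid_mono hnN h3, fun heq => ?_⟩
  -- If the fine point already had the value of the next coarse point, the coarse interval would
  -- have ended there.
  rw [Set.mem_singleton_iff, skeleton_eq hr.symm] at heq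
  have h5 : lebesguePartition S n (j + 1) ≤ (r : WithTop ℝ≥0) :=
    (lebesguePartition_succ_le_iff S n j r).2
      ⟨r, le_rfl, hr ▸ h₁, heq ▸ h3, fun h => h4 (by rw [heq]; exact h)⟩
  exact absurd h₂ (not_lt.2 (hr ▸ h5))

/-- Raising the index by at most one per fine step suffices, since no fine interval jumps over a
coarse point. The strict inequality is what requires the fine time to be finite. -/
theorem coarseIndex_spec {S : PricePath} {n N : ℕ} (hnN : n ≤ N) {l : ℕ}
    (hl : lebesguePartition S N l ≠ ⊤) :
    lebesguePartition S n (coarseIndex S n N l) ≤ lebesguePartition S N l ∧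
      lebesguePartition S N l < lebesguePartition S n (coarseIndex S n N l + 1) := by
  induction l with
  | zero =>
    refine ⟨le_rfl, ?_⟩
    have := lebesguePartition_lt_succ S n 0 hl
    exact this
  | succ l ih =>
    have hl' : lebesguePartition S N l ≠ ⊤ :=
      ne_top_of_le_ne_top hl (lebesguePartition_le_succ S N l)
    obtain ⟨h1, h2⟩ := ih hl'
    rw [coarseIndex]
    split_ifs with h
    · refine ⟨h, ?_⟩
      have heq := le_antisymm h (lebesguePartition_succ_le_of_lt hnN h1 h2)
      rw [← heq]
      exact lebesguePartition_lt_succ S n _ (heq ▸ hl)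
    · exact ⟨h1.trans (lebesguePartition_le_succ S N l), not_le.1 h⟩

/-- Positions constant on the intervals of a coarse partition have the same gains along any finer
one. -/
theorem levelGain_coarseIndex (S : PricePath) {n N : ℕ} (hnN : n ≤ N) (F : ℕ → ℝ) (t : ℝ≥0) :
    levelGain S N (fun l => F (coarseIndex S n N l)) t = levelGain S n F t := by
  -- The invariant at fine points: completed coarse intervals, plus the part of the current one
  -- travelled so far.
  have key : ∀ L, lebesguePartition S N L ≠ ⊤ →
      ∑ l ∈ Finset.range L, F (coarseIndex S n N l) * (skeleton S N (l + 1) - skeleton S N l) =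
      ∑ j ∈ Finset.range (coarseIndex S n N L), F j * (skeleton S n (j + 1) - skeleton S n j) +
        F (coarseIndex S n N L) * (skeleton S N L - skeleton S n (coarseIndex S n N L)) := by
    intro L
    induction L with
    | zero => intro _; simp [coarseIndex, skeleton_zero]
    | succ L ih =>
      intro hL
      have hL' : lebesguePartition S N L ≠ ⊤ :=
        ne_top_of_le_ne_top hL (lebesguePartition_le_succ S N L)
      obtain ⟨h1, h2⟩ := coarseIndex_spec hnN hL'
      rw [Finset.sum_range_succ, ih hL', coarseIndex]
      split_ifs with h
      · have heq := le_antisymm h (lebesguePartition_succ_le_of_lt hnN h1 h2)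
        have : skeleton S n (coarseIndex S n N L + 1) = skeleton S N (L + 1) := by
          rw [skeleton, skeleton, heq]
        rw [Finset.sum_range_succ, this]; ring
      · ring
  obtain ⟨L, h₁, h₂⟩ := exists_lebesguePartition_le_lt S N t
  have hL := ne_top_of_le_ne_top WithTop.coe_ne_top h₁
  obtain ⟨h3, h4⟩ := coarseIndex_spec hnN hL
  rw [levelGain_eq h₁ h₂.le, key L hL,
    levelGain_eq (h3.trans h₁) (h₂.le.trans (lebesguePartition_succ_le_of_lt hnN h3 h4))]
  ring

/-! ### Measurability -/

theorem isStronglyProgressive_eval :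
    IsStronglyProgressive pathFiltration (fun t (ω : PricePath) => ω t) := by
  refine StronglyAdapted.isStronglyProgressive_of_continuous (fun t => ?_) fun ω => ω.continuous
  refine Measurable.stronglyMeasurable ?_
  refine Measurable.mono (comap_measurable (m := borel ℝ) _)
    (le_iSup₂ (f := fun (s : ℝ≥0) (_ : s ≤ t) =>
      MeasurableSpace.comap (fun ω : PricePath => ω s) (borel ℝ)) t le_rfl) ?_
  exact (BorelSpace.measurable_eq (α := ℝ)).le

theorem measurable_valueAtMin {τ : PricePath → WithTop ℝ≥0}
    (hτ : IsStoppingTime pathFiltration τ) (t : ℝ≥0) :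
    Measurable[pathFiltration t] fun ω => valueAtMin ω (τ ω) t :=
  (isStronglyProgressive_eval.stronglyAdapted_stoppedProcess hτ t).measurable

/-- This exhibits the event as a countable combination of quantities observed up to time `t`, so
that the partition points are stopping times for the raw filtration. By continuity and compactness,
a closed set is hit in `[τₖ, t]` as soon as countably many sample times come arbitrarily close to
it; the maximum with `τₖ` and the minimum with `t` keep the sample times in that interval. -/
theorem lebesguePartition_succ_le_iff_forall (S : PricePath) (n k : ℕ) (t : ℝ≥0) :
    lebesguePartition S n (k + 1) ≤ (t : WithTop ℝ≥0) ↔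
      lebesguePartition S n k ≤ (t : WithTop ℝ≥0) ∧ ∀ m : ℕ, ∃ i : ℕ, ∃ d ∈ dyadicGrid n,
        d ≠ valueAtMin S (lebesguePartition S n k) t ∧
        |valueAtMin S (max (lebesguePartition S n k)
          (TopologicalSpace.denseSeq ℝ≥0 i : ℝ≥0)) t - d| < 1 / (m + 1 : ℝ) := by
  constructor
  · intro h
    obtain ⟨s, hst, hks, hsd⟩ := (lebesguePartition_succ_le_iff S n k t).1 h
    have hkt := hks.trans (WithTop.coe_le_coe.2 hst)
    refine ⟨hkt, fun m => ?_⟩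
    obtain ⟨r, hr⟩ := WithTop.ne_top_iff_exists.1 (ne_top_of_le_ne_top WithTop.coe_ne_top hks)
    rw [← hr, WithTop.coe_le_coe] at hks
    have hcont : Continuous fun q : ℝ≥0 => S (min t (max r q)) := by fun_prop
    have hopen : IsOpen {q : ℝ≥0 | |S (min t (max r q)) - S s| < 1 / (m + 1 : ℝ)} :=
      isOpen_lt (by fun_prop) continuous_const
    obtain ⟨i, hi⟩ := (TopologicalSpace.denseRange_denseSeq ℝ≥0).exists_mem_open hopen
      ⟨s, by simp only [Set.mem_ofPred_eq, max_eq_right hks, min_eq_right hst, sub_self, abs_zero]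
             positivity⟩
    refine ⟨i, S s, hsd.1, ?_, ?_⟩
    · rw [valueAtMin_of_le hkt]; exact hsd.2
    · have : valueAtMin S (max (lebesguePartition S n k)
          (TopologicalSpace.denseSeq ℝ≥0 i : ℝ≥0)) t =
          S (min t (max r (TopologicalSpace.denseSeq ℝ≥0 i))) := by
        rw [valueAtMin, ← hr]; rfl
      rw [this]; exact hi
  · rintro ⟨hkt, hm⟩
    obtain ⟨r, hr⟩ := WithTop.ne_top_iff_exists.1 (ne_top_of_le_ne_top WithTop.coe_ne_top hkt)
    rw [valueAtMin_of_le hkt] at hm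
    change ∀ m : ℕ, ∃ i : ℕ, ∃ d ∈ dyadicGrid n, d ≠ skeleton S n k ∧ _ at hm
    rw [← hr, WithTop.coe_le_coe] at hkt
    set D := dyadicGrid n \ {skeleton S n k} with hD
    have hDc : IsClosed D := isClosed_of_subset_dyadicGrid Set.sdiff_subset
    have hDne : D.Nonempty := by
      obtain ⟨i, d, hd, hne, -⟩ := hm 0
      exact ⟨d, hd, hne⟩
    -- The hitting time sought is a point of `[r, t]` where the distance to the closed target set is
    -- minimal; the sampled distances force this minimum to be zero.
    obtain ⟨s, hs, hmin⟩ := (isCompact_Icc (a := r) (b := t)).exists_isMinOn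
      (Set.nonempty_Icc.2 hkt)
      (f := fun s => Metric.infDist (S s) D)
      (((Metric.continuous_infDist_pt D).comp S.continuous).continuousOn)
    refine (lebesguePartition_succ_le_iff S n k t).2
      ⟨s, hs.2, by rw [← hr]; exact WithTop.coe_le_coe.2 hs.1, ?_⟩
    refine (hDc.mem_iff_infDist_zero hDne).2 (le_antisymm ?_ Metric.infDist_nonneg)
    refine le_of_forall_pos_lt_add fun ε hε => ?_
    obtain ⟨m, hmε⟩ := exists_nat_one_div_lt hε
    obtain ⟨i, d, hd, hne, hlt⟩ := hm m
    have hval : valueAtMin S (max (lebesguePartition S n k)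
          (TopologicalSpace.denseSeq ℝ≥0 i : ℝ≥0)) t =
          S (min t (max r (TopologicalSpace.denseSeq ℝ≥0 i))) := by
        rw [valueAtMin, ← hr]; rfl
    rw [hval] at hlt
    have h1 : Metric.infDist (S s) D ≤
        Metric.infDist (S (min t (max r (TopologicalSpace.denseSeq ℝ≥0 i)))) D :=
      hmin ⟨le_min hkt (le_max_left _ _), min_le_left _ _⟩
    have h2 := Metric.infDist_le_dist_of_mem
      (x := S (min t (max r (TopologicalSpace.denseSeq ℝ≥0 i)))) (show d ∈ D from ⟨hd, hne⟩)
    rw [Real.dist_eq] at h2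
    linarith

theorem isStoppingTime_lebesguePartition (n k : ℕ) :
    IsStoppingTime pathFiltration fun ω => lebesguePartition ω n k := by
  induction k with
  | zero => exact isStoppingTime_const pathFiltration (0 : ℝ≥0)
  | succ k ih =>
    intro t
    have : {ω : PricePath | lebesguePartition ω n (k + 1) ≤ (t : WithTop ℝ≥0)} =
        {ω : PricePath | lebesguePartition ω n k ≤ (t : WithTop ℝ≥0)} ∩
        ⋂ m : ℕ, ⋃ i : ℕ, ⋃ d ∈ dyadicGrid n,
          ({ω : PricePath | d ≠ valueAtMin ω (lebesguePartition ω n k) t} ∩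
          {ω : PricePath | |valueAtMin ω (max (lebesguePartition ω n k)
            (TopologicalSpace.denseSeq ℝ≥0 i : ℝ≥0)) t - d| < 1 / (m + 1 : ℝ)}) := by
      ext ω
      simp only [Set.mem_inter_iff, Set.mem_iInter, Set.mem_iUnion, Set.mem_ofPred_eq,
        exists_prop]
      exact lebesguePartition_succ_le_iff_forall ω n k t
    rw [this]
    refine (ih t).inter (MeasurableSet.iInter fun m => MeasurableSet.iUnion fun i =>
      MeasurableSet.biUnion (countable_dyadicGrid n) fun d _ => MeasurableSet.inter ?_ ?_)
    · have h := (measurable_valueAtMin ih t) (measurableSet_singleton d).compl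
      convert! h using 1
      ext ω
      simp [eq_comm]
    · have hopen : IsOpen {x : ℝ | |x - d| < 1 / (m + 1 : ℝ)} :=
        isOpen_lt (by fun_prop) continuous_const
      exact (measurable_valueAtMin (ih.max_const _) t) hopen.measurableSet

theorem measurable_skeleton {n k l : ℕ} (hlk : l ≤ k) :
    Measurable[(isStoppingTime_lebesguePartition n k).measurableSpace]
      fun ω => skeleton ω n l :=
  (measurable_stoppedValue isStronglyProgressive_eval
    (isStoppingTime_lebesguePartition n l)).mono
    (IsStoppingTime.measurableSpace_mono _ _ fun ω => lebesguePartition_mono ω n hlk) le_rfl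

/-! ### Strategies along the dyadic Lebesgue partitions -/

/-- `F` is a sequence of bounded positions `F k` known at the `k`-th point of the dyadic Lebesgue
partition of level `n`. -/
structure IsLevelStrategy (n : ℕ) (F : ℕ → PricePath → ℝ) : Prop where
  measurable : ∀ k, Measurable[(isStoppingTime_lebesguePartition n k).measurableSpace] (F k)
  bounded : ∀ k, ∃ C : ℝ, ∀ ω, |F k ω| ≤ C

namespace IsLevelStrategy

variable {n N : ℕ} {F G : ℕ → PricePath → ℝ}

theorem zero (n : ℕ) : IsLevelStrategy n 0 :=
  ⟨fun _ => measurable_const, fun _ => ⟨0, fun _ => by simp⟩⟩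

theorem add (hF : IsLevelStrategy n F) (hG : IsLevelStrategy n G) : IsLevelStrategy n (F + G) := by
  refine ⟨fun k => (hF.measurable k).add (hG.measurable k), fun k => ?_⟩
  obtain ⟨C, hC⟩ := hF.bounded k
  obtain ⟨D, hD⟩ := hG.bounded k
  exact ⟨C + D, fun ω => (abs_add_le _ _).trans (add_le_add (hC ω) (hD ω))⟩

theorem smul (c : ℝ) (hF : IsLevelStrategy n F) : IsLevelStrategy n (c • F) := by
  refine ⟨fun k => (hF.measurable k).const_smul c, fun k => ?_⟩
  obtain ⟨C, hC⟩ := hF.bounded k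
  refine ⟨|c| * C, fun ω => ?_⟩
  simp only [Pi.smul_apply, smul_eq_mul, abs_mul]
  exact mul_le_mul_of_nonneg_left (hC ω) (abs_nonneg c)

/-- The simple strategy with the given positions. -/
def toSimple (hF : IsLevelStrategy n F) : SimpleStrategy where
  τ k ω := lebesguePartition ω n k
  isStoppingTime := isStoppingTime_lebesguePartition n
  τ_zero _ := rfl
  τ_mono k ω := lebesguePartition_le_succ ω n k
  τ_strict k ω := lebesguePartition_lt_succ ω n k
  τ_finite ω T := finite_lebesguePartition_le ω n T
  F := F
  F_measurable := hF.measurable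
  F_bounded := hF.bounded

theorem integral_toSimple (hF : IsLevelStrategy n F) (t : ℝ≥0) (ω : PricePath) :
    hF.toSimple.integral t ω = levelGain ω n (fun k => F k ω) t := rfl

end IsLevelStrategy

theorem lebesguePartition_coarseIndex_le (ω : PricePath) {n N : ℕ} (hnN : n ≤ N) (l : ℕ) :
    lebesguePartition ω n (coarseIndex ω n N l) ≤ lebesguePartition ω N l := by
  by_cases h : lebesguePartition ω N l = ⊤
  · rw [h]; exact le_top
  · exact (coarseIndex_spec hnN h).1

theorem measurableSet_coarseIndex_eq (n N l j : ℕ) :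
    MeasurableSet[(isStoppingTime_lebesguePartition N l).measurableSpace]
      {ω | coarseIndex ω n N l = j} := by
  induction l generalizing j with
  | zero => simp only [coarseIndex]; exact MeasurableSet.const _
  | succ l ih =>
    have hle := IsStoppingTime.measurableSpace_mono (isStoppingTime_lebesguePartition N l)
      (isStoppingTime_lebesguePartition N (l + 1)) fun ω => lebesguePartition_le_succ ω N l
    have hset : ∀ i, MeasurableSet[(isStoppingTime_lebesguePartition N (l + 1)).measurableSpace]
        {ω | lebesguePartition ω n (i + 1) ≤ lebesguePartition ω N (l + 1)} := fun i =>
      IsStoppingTime.measurableSet_stopping_time_le (isStoppingTime_lebesguePartition n (i + 1)) _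
    have : {ω | coarseIndex ω n N (l + 1) = j} =
        ⋃ i : ℕ, {ω | coarseIndex ω n N l = i} ∩
          (({ω | lebesguePartition ω n (i + 1) ≤ lebesguePartition ω N (l + 1)} ∩
            {_ω | i + 1 = j}) ∪
          ({ω | lebesguePartition ω n (i + 1) ≤ lebesguePartition ω N (l + 1)}ᶜ ∩
            {_ω | i = j})) := by
      ext ω
      simp only [coarseIndex, Set.mem_ofPred_eq, Set.mem_iUnion, Set.mem_inter_iff, Set.mem_union,
        Set.mem_compl_iff, exists_eq_left']
      split_ifs with h <;> simp [h]
    rw [this]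
    exact MeasurableSet.iUnion fun i => (hle _ (ih i)).inter
      (((hset i).inter (MeasurableSet.const _)).union
        ((hset i).compl.inter (MeasurableSet.const _)))

/-- The value at the current coarse index of a process adapted to a coarse partition is known at
the points of the fine partition. -/
theorem measurable_coarseIndex {n N : ℕ} (hnN : n ≤ N) {F : ℕ → PricePath → ℝ}
    (hF : ∀ k, Measurable[(isStoppingTime_lebesguePartition n k).measurableSpace] (F k)) (l : ℕ) :
    Measurable[(isStoppingTime_lebesguePartition N l).measurableSpace]
      fun ω => F (coarseIndex ω n N l) ω := by
  intro B hB
  -- The added event is automatic when the coarse index is `j`. Intersecting with it moves an event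
  -- known at the coarse time to the σ-algebra of the later fine time.
  have : (fun ω => F (coarseIndex ω n N l) ω) ⁻¹' B =
      ⋃ j : ℕ, {ω | coarseIndex ω n N l = j} ∩
        (F j ⁻¹' B ∩ {ω | lebesguePartition ω n j ≤ lebesguePartition ω N l}) := by
    ext ω
    simp only [Set.mem_preimage, Set.mem_iUnion, Set.mem_inter_iff, Set.mem_ofPred_eq,
      exists_eq_left']
    exact ⟨fun h => ⟨h, lebesguePartition_coarseIndex_le ω hnN l⟩, fun h => h.1⟩
  rw [this]
  refine MeasurableSet.iUnion fun j => (measurableSet_coarseIndex_eq n N l j).inter ?_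
  have h := IsStoppingTime.measurableSet_inter_le (isStoppingTime_lebesguePartition n j)
    (isStoppingTime_lebesguePartition N l) _ (hF j hB)
  exact ((IsStoppingTime.measurableSet_min_iff (isStoppingTime_lebesguePartition n j)
    (isStoppingTime_lebesguePartition N l) _).1 h).2

theorem IsLevelStrategy.refine {n N : ℕ} {F : ℕ → PricePath → ℝ} (hF : IsLevelStrategy n F)
    (hnN : n ≤ N) : IsLevelStrategy N fun l ω => F (coarseIndex ω n N l) ω := by
  refine ⟨fun l => measurable_coarseIndex hnN hF.measurable l, fun l => ?_⟩
  choose C hC using hF.bounded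
  refine ⟨∑ j ∈ Finset.range (l + 1), |C j|, fun ω => ?_⟩
  refine ((hC _ ω).trans (le_abs_self _)).trans ?_
  exact Finset.single_le_sum (f := fun j => |C j|) (fun j _ => abs_nonneg _)
    (Finset.mem_range.2 (Nat.lt_succ_of_le (coarseIndex_le ω n N l)))

/-- Finite combinations of gains along dyadic Lebesgue partitions of various levels are gains of
simple strategies. -/
theorem exists_simpleStrategy_sum {N : ℕ → ℕ} {F : ℕ → ℕ → PricePath → ℝ}
    (hF : ∀ i, IsLevelStrategy (N i) (F i)) (c : ℕ → ℝ) (m : ℕ) :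
    ∃ H : SimpleStrategy, ∀ t ω, H.integral t ω =
      ∑ i ∈ Finset.range m, c i * levelGain ω (N i) (fun k => F i k ω) t := by
  -- All strategies are rewritten on one common refinement, where positions can be added.
  obtain ⟨M, hM⟩ : ∃ M, ∀ i ∈ Finset.range m, N i ≤ M :=
    ⟨(Finset.range m).sup N, fun i hi => Finset.le_sup hi⟩
  have key : ∀ m' ≤ m, ∃ G, IsLevelStrategy M G ∧ ∀ t ω, levelGain ω M (fun k => G k ω) t =
      ∑ i ∈ Finset.range m', c i * levelGain ω (N i) (fun k => F i k ω) t := by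
    intro m'
    induction m' with
    | zero =>
      refine fun _ => ⟨0, IsLevelStrategy.zero M, fun t ω => ?_⟩
      simp [levelGain]
    | succ m' ih =>
      intro hm
      obtain ⟨G, hG, hGt⟩ := ih (by omega)
      have hNM := hM m' (Finset.mem_range.2 hm)
      refine ⟨_, hG.add (((hF m').refine hNM).smul (c m')), fun t ω => ?_⟩
      rw [Finset.sum_range_succ, ← hGt, ← levelGain_coarseIndex ω hNM, ← levelGain_smul,
        ← levelGain_add]
      rfl
  obtain ⟨G, hG, hGt⟩ := key m le_rfl
  exact ⟨hG.toSimple, fun t ω => by rw [hG.integral_toSimple, hGt]⟩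

/-! ### Multiplicative betting -/

/-- The wealth obtained from unit capital by multiplying with `1 + x k` in round `k`, frozen as
soon as it reaches the level `K`. -/
def frozenWealth (K : ℝ) (x : ℕ → ℝ) : ℕ → ℝ
  | 0 => 1
  | k + 1 => if K ≤ frozenWealth K x k then frozenWealth K x k
      else frozenWealth K x k * (1 + x k)

/-- Each factor lies in `[1/2, 3/2]`. The lower bound yields admissibility, the upper one bounded
positions. -/
theorem frozenWealth_mem {K : ℝ} {x : ℕ → ℝ} {J : ℕ} (hx : ∀ k < J, |x k| ≤ 1 / 2) :
    0 ≤ frozenWealth K x J ∧ frozenWealth K x J ≤ (3 / 2) ^ J := by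
  induction J with
  | zero => simp [frozenWealth]
  | succ J ih =>
    obtain ⟨h1, h2⟩ := ih fun k hk => hx k (by omega)
    have h3 := abs_le.1 (hx J (by omega))
    have h4 : (0 : ℝ) ≤ (3 / 2) ^ J := by positivity
    rw [frozenWealth, pow_succ]
    split_ifs
    · constructor <;> nlinarith
    · exact ⟨mul_nonneg h1 (by linarith), mul_le_mul h2 (by linarith) (by linarith) h4⟩

theorem frozenWealth_eq_of_le {K : ℝ} {x : ℕ → ℝ} {I J : ℕ} (hI : K ≤ frozenWealth K x I)
    (hIJ : I ≤ J) : frozenWealth K x J = frozenWealth K x I := by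
  induction J, hIJ using Nat.le_induction with
  | base => rfl
  | succ J _ ih => rw [frozenWealth, if_pos (by rw [ih]; exact hI), ih]

/-- Until the level `K` is first reached the frozen wealth is the plain product, so it cannot miss
`K` if the product reaches it. -/
theorem exists_le_frozenWealth {K : ℝ} {x : ℕ → ℝ} {J : ℕ}
    (hK : K ≤ ∏ k ∈ Finset.range J, (1 + x k)) : ∃ I ≤ J, K ≤ frozenWealth K x I := by
  by_contra hcon
  push Not at hcon
  have : ∀ I ≤ J, frozenWealth K x I = ∏ k ∈ Finset.range I, (1 + x k) := by
    intro I
    induction I with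
    | zero => intro _; simp [frozenWealth]
    | succ I ih =>
      intro hI
      rw [frozenWealth, if_neg (not_le.2 (hcon I (by omega))), ih (by omega),
        Finset.prod_range_succ]
  exact absurd (hcon J le_rfl) (not_lt.2 (by rw [this J le_rfl]; exact hK))

open Classical in
/-- The position that realizes the frozen multiplicative wealth for the relative bets `h`. -/
def bettingPosition (n : ℕ) (K : ℝ) (h : ℕ → PricePath → ℝ) (k : ℕ) (ω : PricePath) : ℝ :=
  -- At an infinite time the skeleton value is junk and the wealth bound is lost; position `0` keeps
  -- the strategy bounded on every path.
  if lebesguePartition ω n k = ⊤ ∨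
      K ≤ frozenWealth K (fun l => h l ω * (skeleton ω n (l + 1) - skeleton ω n l)) k then 0
  else frozenWealth K (fun l => h l ω * (skeleton ω n (l + 1) - skeleton ω n l)) k * h k ω

theorem abs_skeleton_succ_sub_le {S : PricePath} {n k : ℕ}
    (hk : lebesguePartition S n (k + 1) ≠ ⊤) :
    |skeleton S n (k + 1) - skeleton S n k| ≤ ((2 : ℝ) ^ n)⁻¹ := by
  obtain ⟨t, ht⟩ := WithTop.ne_top_iff_exists.1 hk
  rw [skeleton_eq ht.symm]
  exact abs_sub_skeleton_le (ht ▸ lebesguePartition_le_succ S n k) ht.le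

theorem lebesguePartition_ne_top_of_le {S : PricePath} {n j k : ℕ}
    (hk : lebesguePartition S n k ≠ ⊤) (hjk : j ≤ k) : lebesguePartition S n j ≠ ⊤ :=
  ne_top_of_le_ne_top hk (lebesguePartition_mono S n hjk)

section

variable {n : ℕ} {h : ℕ → PricePath → ℝ}

theorem abs_bet_le (hb : ∀ k ω, |h k ω| ≤ 2 ^ n / 2) {ω : PricePath} {J : ℕ}
    (hJ : lebesguePartition ω n J ≠ ⊤) :
    ∀ k < J, |h k ω * (skeleton ω n (k + 1) - skeleton ω n k)| ≤ 1 / 2 := by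
  intro k hk
  rw [abs_mul]
  calc |h k ω| * |skeleton ω n (k + 1) - skeleton ω n k|
      ≤ 2 ^ n / 2 * ((2 : ℝ) ^ n)⁻¹ := mul_le_mul (hb k ω)
        (abs_skeleton_succ_sub_le (lebesguePartition_ne_top_of_le hJ hk)) (abs_nonneg _)
        (by positivity)
    _ = 1 / 2 := by field_simp

theorem measurable_frozenWealth (K : ℝ)
    (hm : ∀ k, Measurable[(isStoppingTime_lebesguePartition n k).measurableSpace] (h k)) (k : ℕ) :
    Measurable[(isStoppingTime_lebesguePartition n k).measurableSpace] fun ω =>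
      frozenWealth K (fun l => h l ω * (skeleton ω n (l + 1) - skeleton ω n l)) k := by
  induction k with
  | zero => exact measurable_const
  | succ k ih =>
    have hle := IsStoppingTime.measurableSpace_mono (isStoppingTime_lebesguePartition n k)
      (isStoppingTime_lebesguePartition n (k + 1)) fun ω => lebesguePartition_le_succ ω n k
    have ih' := ih.mono hle le_rfl
    have hk' := (hm k).mono hle le_rfl
    simp only [frozenWealth]
    refine Measurable.ite (ih' measurableSet_Ici) ih' (ih'.mul (measurable_const.add (hk'.mul ?_)))
    exact (measurable_skeleton le_rfl).sub (measurable_skeleton (Nat.le_succ k))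

theorem isLevelStrategy_bettingPosition (K : ℝ)
    (hm : ∀ k, Measurable[(isStoppingTime_lebesguePartition n k).measurableSpace] (h k))
    (hb : ∀ k ω, |h k ω| ≤ 2 ^ n / 2) : IsLevelStrategy n (bettingPosition n K h) := by
  refine ⟨fun k => ?_, fun k => ⟨(3 / 2) ^ k * (2 ^ n / 2), fun ω => ?_⟩⟩
  · refine Measurable.ite (MeasurableSet.union ?_ ?_) measurable_const
      ((measurable_frozenWealth K hm k).mul (hm k))
    · exact (isStoppingTime_lebesguePartition n k).measurable (measurableSet_singleton ⊤)
    · exact (measurable_frozenWealth K hm k) measurableSet_Ici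
  · rw [bettingPosition]
    split_ifs with hif
    · rw [abs_zero]; positivity
    · push Not at hif
      obtain ⟨h1, h2⟩ := frozenWealth_mem (K := K) (abs_bet_le hb hif.1)
      rw [abs_mul, abs_of_nonneg h1]
      exact mul_le_mul h2 (hb k ω) (abs_nonneg _) (by positivity)

/-- Over a complete interval the gain is exactly the increment of the frozen wealth, so the sum
telescopes and only the running interval remains. -/
theorem levelGain_bettingPosition (K : ℝ) {ω : PricePath} {t : ℝ≥0} {J : ℕ}
    (h₁ : lebesguePartition ω n J ≤ (t : WithTop ℝ≥0))
    (h₂ : (t : WithTop ℝ≥0) ≤ lebesguePartition ω n (J + 1)) :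
    levelGain ω n (fun k => bettingPosition n K h k ω) t =
      frozenWealth K (fun l => h l ω * (skeleton ω n (l + 1) - skeleton ω n l)) J - 1 +
        bettingPosition n K h J ω * (ω t - skeleton ω n J) := by
  rw [levelGain_eq h₁ h₂]
  congr 1
  have hJ := ne_top_of_le_ne_top WithTop.coe_ne_top h₁
  clear h₁ h₂
  induction J with
  | zero => simp [frozenWealth]
  | succ J ih =>
    have hJ' := lebesguePartition_ne_top_of_le hJ (Nat.le_succ J)
    rw [Finset.sum_range_succ, ih hJ', frozenWealth, bettingPosition]
    by_cases hK : K ≤ frozenWealth K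
        (fun l => h l ω * (skeleton ω n (l + 1) - skeleton ω n l)) J
    · rw [if_pos (Or.inr hK), if_pos hK]; ring
    · rw [if_neg (by push Not; exact ⟨hJ', not_le.1 hK⟩), if_neg hK]; ring

/-- Admissibility is needed between partition points too. There the path has moved by at most `2⁻ⁿ`,
so the running factor is still at least `1/2`. -/
theorem neg_one_le_levelGain_bettingPosition (K : ℝ) (hb : ∀ k ω, |h k ω| ≤ 2 ^ n / 2)
    (ω : PricePath) (t : ℝ≥0) :
    -1 ≤ levelGain ω n (fun k => bettingPosition n K h k ω) t := by
  obtain ⟨J, h₁, h₂⟩ := exists_lebesguePartition_le_lt ω n t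
  have hJ := ne_top_of_le_ne_top WithTop.coe_ne_top h₁
  rw [levelGain_bettingPosition K h₁ h₂.le, bettingPosition]
  obtain ⟨h3, -⟩ := frozenWealth_mem (K := K) (abs_bet_le hb hJ)
  split_ifs
  · linarith
  · have h4 : |h J ω * (ω t - skeleton ω n J)| ≤ 1 / 2 := by
      rw [abs_mul]
      calc |h J ω| * |ω t - skeleton ω n J| ≤ 2 ^ n / 2 * ((2 : ℝ) ^ n)⁻¹ :=
            mul_le_mul (hb J ω) (abs_sub_skeleton_le h₁ h₂.le) (abs_nonneg _) (by positivity)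
        _ = 1 / 2 := by field_simp
    rw [mul_assoc]
    nlinarith [(abs_le.1 h4).1]

/-- This is what freezing is for: once `K` is reached the position is zero, so the gain survives the
limit inferior in time. -/
theorem le_levelGain_bettingPosition {K : ℝ} {ω : PricePath} {J : ℕ}
    (hK : K ≤ ∏ k ∈ Finset.range J, (1 + h k ω * (skeleton ω n (k + 1) - skeleton ω n k)))
    {t : ℝ≥0} (ht : lebesguePartition ω n J ≤ (t : WithTop ℝ≥0)) :
    K - 1 ≤ levelGain ω n (fun k => bettingPosition n K h k ω) t := by
  obtain ⟨I, hIJ, hI⟩ := exists_le_frozenWealth hK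
  obtain ⟨L, h₁, h₂⟩ := exists_lebesguePartition_le_lt ω n t
  have hJL : J ≤ L := by
    by_contra hlt
    exact absurd (h₂.trans_le (lebesguePartition_mono ω n (by omega : L + 1 ≤ J))) (not_lt.2 ht)
  have hL := frozenWealth_eq_of_le hI (hIJ.trans hJL)
  rw [levelGain_bettingPosition K h₁ h₂.le, hL, bettingPosition, if_pos (Or.inr (by rwa [hL]))]
  linarith

end

/-- For typical price paths, the weighted multiplicative wealths of countably many bets are bounded
uniformly in the bets and in time. -/
theorem forTypicalPaths_bets_bounded {N : ℕ → ℕ} {h : ℕ → ℕ → PricePath → ℝ} {w : ℕ → ℝ}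
    (hm : ∀ i k, Measurable[(isStoppingTime_lebesguePartition (N i) k).measurableSpace] (h i k))
    (hb : ∀ i k ω, |h i k ω| ≤ 2 ^ N i / 2) (hw : ∀ i, 0 < w i) (hsum : Summable w) :
    ForTypicalPaths fun ω => ∃ B : ℝ, ∀ i J, lebesguePartition ω (N i) J ≠ ⊤ →
      w i * ∏ k ∈ Finset.range J,
        (1 + h i k ω * (skeleton ω (N i) (k + 1) - skeleton ω (N i) k)) ≤ B := by
  set W := ∑' i, w i with hW
  have hWpos : 0 < W := hsum.tsum_pos (fun i => (hw i).le) 0 (hw 0)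
  rw [ForTypicalPaths]
  set A := {ω : PricePath | ¬ ∃ B : ℝ, ∀ i J, lebesguePartition ω (N i) J ≠ ⊤ →
      w i * ∏ k ∈ Finset.range J,
        (1 + h i k ω * (skeleton ω (N i) (k + 1) - skeleton ω (N i) k)) ≤ B} with hA
  have key : ∀ ε : ℝ, 0 < ε → Superhedges (ε * W) A := by
    intro ε hε
    -- Capital `ε * w i` goes into account `i`, which is frozen once it is worth `1` by itself. The
    -- `m`-th strategy runs the first `m` accounts and keeps the remaining capital as cash.
    have hF : ∀ i, IsLevelStrategy (N i) (bettingPosition (N i) (1 / (ε * w i)) (h i)) :=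
      fun i => isLevelStrategy_bettingPosition _ (hm i) (hb i)
    choose H hH using fun m => exists_simpleStrategy_sum hF (fun i => ε * w i) m
    have hwealth : ∀ m t ω, ∑ i ∈ Finset.range m, ε * w i *
        (1 + levelGain ω (N i) (fun k => bettingPosition (N i) (1 / (ε * w i)) (h i) k ω) t) ≤
        ε * W + (H m).integral t ω := by
      intro m t ω
      rw [hH]
      simp only [mul_add, mul_one, Finset.sum_add_distrib]
      gcongr
      rw [← Finset.mul_sum]
      exact mul_le_mul_of_nonneg_left (hsum.sum_le_tsum _ fun i _ => (hw i).le) hε.le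
    have hterm : ∀ i t ω, 0 ≤ ε * w i *
        (1 + levelGain ω (N i) (fun k => bettingPosition (N i) (1 / (ε * w i)) (h i) k ω) t) := by
      intro i t ω
      have := neg_one_le_levelGain_bettingPosition (1 / (ε * w i)) (hb i) ω t
      exact mul_nonneg (mul_pos hε (hw i)).le (by linarith)
    have hnonneg : ∀ m t ω, 0 ≤ ε * W + (H m).integral t ω := fun m t ω =>
      (Finset.sum_nonneg fun i _ => hterm i t ω).trans (hwealth m t ω)
    refine ⟨H, fun m t ω => by linarith [hnonneg m t ω], fun ω => ?_⟩
    by_cases hω : ω ∈ A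
    · rw [Set.indicator_of_mem hω]
      simp only [hA, Set.mem_ofPred_eq, not_exists, not_forall, not_le] at hω
      -- On the exceptional set some weighted product exceeds `1 / ε`, which says that account `i`
      -- reaches its freezing level.
      obtain ⟨i, J, hJ, hlt⟩ := hω (1 / ε)
      obtain ⟨t₀, ht₀⟩ := WithTop.ne_top_iff_exists.1 hJ
      refine le_liminf_of_le (by isBoundedDefault) ?_
      filter_upwards [eventually_ge_atTop t₀] with t ht
      refine le_liminf_of_le (by isBoundedDefault) ?_
      filter_upwards [eventually_gt_atTop i] with m hmi
      have hK : 1 / (ε * w i) ≤ ∏ k ∈ Finset.range J,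
          (1 + h i k ω * (skeleton ω (N i) (k + 1) - skeleton ω (N i) k)) := by
        rw [div_lt_iff₀ hε] at hlt
        rw [div_le_iff₀ (mul_pos hε (hw i))]
        linarith
      have hgain := le_levelGain_bettingPosition (n := N i) (h := h i) hK
        (t := t) (by rw [← ht₀]; exact WithTop.coe_le_coe.2 ht)
      have h1 : (1 : ℝ) ≤ ε * W + (H m).integral t ω := by
        refine le_trans ?_ (hwealth m t ω)
        refine le_trans ?_ (Finset.single_le_sum (fun i _ => hterm i t ω) (Finset.mem_range.2 hmi))
        have h2 : 1 = ε * w i * (1 / (ε * w i)) := by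
          rw [mul_one_div_cancel (mul_pos hε (hw i)).ne']
        refine h2.le.trans ?_
        exact mul_le_mul_of_nonneg_left (by linarith) (mul_pos hε (hw i)).le
      exact_mod_cast h1
    · rw [Set.indicator_of_notMem hω]
      refine le_liminf_of_le (by isBoundedDefault) (Eventually.of_forall fun t => ?_)
      refine le_liminf_of_le (by isBoundedDefault) (Eventually.of_forall fun m => ?_)
      exact_mod_cast hnonneg m t ω
  refine le_antisymm (ENNReal.le_of_forall_pos_le_add fun ε hε _ => ?_) bot_le
  have hε' : (0 : ℝ) < ε / W := div_pos hε hWpos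
  have hεW : (ε : ℝ) / W * W = ε := div_mul_cancel₀ _ hWpos.ne'
  rw [zero_add]
  refine (iInf₂_le (ε / W * W) (mul_pos hε' hWpos)).trans ((iInf_le _ (key _ hε')).trans ?_)
  rw [hεW, ENNReal.ofReal_coe_nnreal]

/-! ### An exponential inequality for typical price paths -/

open Classical in
/-- Indicator of the partition points at which the path lies below `u`. -/
def belowIndicator (S : PricePath) (n : ℕ) (u : ℝ) (l : ℕ) : ℝ :=
  if skeleton S n l < u then 1 else 0

open Classical in
/-- Indicator of the partition points at which the path visits `d`. -/
def visitIndicator (S : PricePath) (n : ℕ) (d : ℝ) (l : ℕ) : ℝ :=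
  if skeleton S n l = d then 1 else 0

/-- The positions whose gains have to be controlled: the visits of a point `d`, and the change of
`belowIndicator` between two consecutive levels. -/
def localPosition (S : PricePath) (n : ℕ) (d : ℝ) : Bool → ℕ → ℝ
  | false => visitIndicator S n d
  | true => fun l =>
      belowIndicator S n d l - belowIndicator S (n - 1) d (coarseIndex S (n - 1) n l)

theorem abs_localPosition_le (S : PricePath) (n : ℕ) (d : ℝ) (b : Bool) (l : ℕ) :
    |localPosition S n d b l| ≤ 1 := by
  cases b <;> simp only [localPosition, visitIndicator, belowIndicator] <;> split_ifs <;> simp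

theorem measurable_localPosition (n : ℕ) (d : ℝ) (b : Bool) (l : ℕ) :
    Measurable[(isStoppingTime_lebesguePartition n l).measurableSpace]
      fun ω => localPosition ω n d b l := by
  have hbelow : ∀ m k, Measurable[(isStoppingTime_lebesguePartition m k).measurableSpace]
      fun ω => belowIndicator ω m d k := fun m k =>
    Measurable.ite ((measurable_skeleton le_rfl) measurableSet_Iio) measurable_const
      measurable_const
  cases b
  · exact Measurable.ite ((measurable_skeleton le_rfl) (measurableSet_singleton d))
      measurable_const measurable_const
  · exact (hbelow n l).sub (measurable_coarseIndex (Nat.sub_le n 1)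
      (F := fun k ω => belowIndicator ω (n - 1) d k) (hbelow (n - 1)) l)

theorem sub_two_mul_sq_le_log {x : ℝ} (hx : |x| ≤ 1 / 2) : x - 2 * x ^ 2 ≤ Real.log (1 + x) := by
  have h := Real.abs_log_sub_add_sum_range_le (x := -x) (by rw [abs_neg]; linarith) 1
  simp only [Finset.sum_range_one, abs_neg] at h
  norm_num at h
  have h2 : x ^ 2 / (1 - |x|) ≤ 2 * x ^ 2 := by
    rw [div_le_iff₀ (by linarith)]
    nlinarith [sq_nonneg x]
  linarith [(abs_le.1 (h.trans h2)).1]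

/-- Converts a bound on multiplicative wealth into a bound on gains, at the cost of twice the sum of
squared bets. -/
theorem sum_sub_le_log_prod {x : ℕ → ℝ} {J : ℕ} (hx : ∀ k < J, |x k| ≤ 1 / 2) :
    0 < ∏ k ∈ Finset.range J, (1 + x k) ∧
    ∑ k ∈ Finset.range J, x k - 2 * ∑ k ∈ Finset.range J, x k ^ 2 ≤
      Real.log (∏ k ∈ Finset.range J, (1 + x k)) := by
  have hpos : ∀ k ∈ Finset.range J, 0 < 1 + x k := fun k hk => by
    linarith [(abs_le.1 (hx k (Finset.mem_range.1 hk))).1]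
  refine ⟨Finset.prod_pos hpos, ?_⟩
  rw [Real.log_prod (fun k hk => (hpos k hk).ne'), Finset.mul_sum, ← Finset.sum_sub_distrib]
  exact Finset.sum_le_sum fun k hk => sub_two_mul_sq_le_log (hx k (Finset.mem_range.1 hk))

/-- The index consists of the level, the grid point, the sign of the bet and the kind of position.
Polynomial weights in `k` and geometric ones in `n` cost only `log (2 ^ n * (1 + k ^ 2))` after
taking logarithms. -/
theorem summable_weights :
    Summable fun i : ℕ × ℤ × Bool × Bool => ((2 : ℝ) ^ i.1)⁻¹ * (1 + (i.2.1 : ℝ) ^ 2)⁻¹ := by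
  have h1 : Summable fun n : ℕ => ((2 : ℝ) ^ n)⁻¹ := by
    simpa using summable_geometric_two
  have h2 : Summable fun k : ℤ => (1 + (k : ℝ) ^ 2)⁻¹ := by
    have h3 : Summable fun k : ℤ => 1 / |(k : ℝ)| ^ (2 : ℝ) :=
      Real.summable_one_div_int_pow (p := 2) |>.mpr (by norm_num) |>.congr fun k => by
        rw [Real.rpow_two, sq_abs]
    refine Summable.of_norm_bounded_eventually h3 ?_
    have : ∀ᶠ k : ℤ in cofinite, k ≠ 0 := (Set.finite_singleton 0).eventually_cofinite_notMem
    filter_upwards [this] with k hk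
    have hk' : (0 : ℝ) < (k : ℝ) ^ 2 := by positivity
    rw [Real.norm_of_nonneg (by positivity), Real.rpow_two, sq_abs, one_div]
    exact inv_anti₀ hk' (by linarith)
  have h4 : Summable fun i : ℤ × Bool × Bool => (1 + (i.1 : ℝ) ^ 2)⁻¹ * (1 : ℝ) :=
    h2.mul_of_nonneg (Summable.of_finite (f := fun _ : Bool × Bool => (1 : ℝ)))
      (fun k => by positivity) (fun _ => zero_le_one)
  have h5 := h1.mul_of_nonneg h4 (fun n => by positivity) (fun i => by positivity)
  simpa using h5

/-- The scale `2^{-n/2}`. -/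
def rootScale (n : ℕ) : ℝ := ((√2) ^ n)⁻¹

theorem rootScale_pos (n : ℕ) : 0 < rootScale n := by
  have : (0 : ℝ) < √2 := by positivity
  rw [rootScale]; positivity

theorem rootScale_sq (n : ℕ) : rootScale n ^ 2 = ((2 : ℝ) ^ n)⁻¹ := by
  rw [rootScale, inv_pow, ← pow_mul, mul_comm, pow_mul, Real.sq_sqrt (by norm_num)]

theorem rootScale_le_one (n : ℕ) : rootScale n ≤ 1 := by
  have h : rootScale n ^ 2 ≤ 1 := by
    rw [rootScale_sq]; exact inv_le_one_of_one_le₀ (one_le_pow₀ (by norm_num))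
  nlinarith [rootScale_pos n]

theorem Superhedges.mono {lam : ℝ} {A A' : Set PricePath} (h : Superhedges lam A)
    (hA : A' ⊆ A) : Superhedges lam A' := by
  obtain ⟨H, hadm, hH⟩ := h
  exact ⟨H, hadm, fun ω => (Set.indicator_le_indicator_of_subset hA
    (fun _ => zero_le_one) ω).trans (hH ω)⟩

theorem ForTypicalPaths.mono {P Q : PricePath → Prop} (hP : ForTypicalPaths P)
    (hPQ : ∀ ω, P ω → Q ω) : ForTypicalPaths Q := by
  refine le_antisymm (le_trans ?_ hP.le) bot_le
  refine iInf₂_mono fun lam _ => iInf_mono' fun h => ⟨h.mono fun ω hω hp => hω (hPQ ω hp), le_rfl⟩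

/-- The gains of the local positions of the path `S` are controlled by their quadratic variations,
up to a logarithmic loss with constant `B`. -/
def LocalGainBound (S : PricePath) (B : ℝ) : Prop :=
  ∀ (n : ℕ) (k : ℤ) (b : Bool) (J : ℕ) (t : ℝ≥0),
    lebesguePartition S n J ≤ (t : WithTop ℝ≥0) →
    (t : WithTop ℝ≥0) ≤ lebesguePartition S n (J + 1) →
    |levelGain S n (localPosition S n (k * ((2 : ℝ) ^ n)⁻¹) b) t| ≤
      rootScale n ^ 2 + 2 * rootScale n * Real.log (B * (1 + (k : ℝ) ^ 2) * 2 ^ n) +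
      rootScale n * (((2 : ℝ) ^ n)⁻¹ *
        ∑ l ∈ Finset.range J, localPosition S n (k * ((2 : ℝ) ^ n)⁻¹) b l ^ 2)

/-- For typical price paths, the gains of the local positions are controlled by their quadratic
variations, with a loss that is only logarithmic in the number of positions. -/
theorem forTypicalPaths_localGain_le :
    ForTypicalPaths fun S => ∃ B : ℝ, 0 < B ∧ LocalGainBound S B := by
  obtain ⟨hden⟩ := nonempty_denumerable (ℕ × ℤ × Bool × Bool)
  set e := (Denumerable.eqv (ℕ × ℤ × Bool × Bool)).symm
  set sgn : Bool → ℝ := fun s => if s then 1 else -1 with hsgn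
  have hsgn1 : ∀ s, |sgn s| = 1 := fun s => by cases s <;> simp [hsgn]
  -- The bet size `2^{n/2}/2` balances the two errors: after division by it, the logarithm and the
  -- quadratic variation `2⁻ⁿ Σ q²`, expected to be of order one, both carry the factor `2^{-n/2}`.
  set h : (ℕ × ℤ × Bool × Bool) → ℕ → PricePath → ℝ := fun i l ω =>
    sgn i.2.2.1 * ((rootScale i.1)⁻¹ / 2) *
      localPosition ω i.1 (i.2.1 * ((2 : ℝ) ^ i.1)⁻¹) i.2.2.2 l with hh
  have hbd : ∀ i l ω, |h i l ω| ≤ 2 ^ i.1 / 2 := by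
    intro i l ω
    have h1 : (rootScale i.1)⁻¹ ≤ 2 ^ i.1 := by
      rw [rootScale, inv_inv]
      exact pow_le_pow_left₀ (Real.sqrt_nonneg 2)
        (Real.sqrt_le_iff.2 ⟨by norm_num, by norm_num⟩) _
    have h2 := rootScale_pos i.1
    simp only [hh]
    rw [abs_mul, abs_mul, hsgn1, one_mul, abs_of_pos (by positivity : 0 < (rootScale i.1)⁻¹ / 2)]
    calc (rootScale i.1)⁻¹ / 2 * |_| ≤ (rootScale i.1)⁻¹ / 2 * 1 :=
          mul_le_mul_of_nonneg_left (abs_localPosition_le _ _ _ _ _) (by positivity)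
      _ ≤ 2 ^ i.1 / 2 := by linarith
  have key := forTypicalPaths_bets_bounded (N := fun i => (e i).1) (h := fun i => h (e i))
    (w := fun i => ((2 : ℝ) ^ (e i).1)⁻¹ * (1 + ((e i).2.1 : ℝ) ^ 2)⁻¹)
    (fun i k => measurable_const.mul (measurable_localPosition _ _ _ _))
    (fun i k ω => hbd (e i) k ω) (fun i => by positivity)
    (summable_weights.comp_injective e.injective)
  refine key.mono fun S hS => ?_
  obtain ⟨B₀, hB₀⟩ := hS
  refine ⟨max B₀ 1, by positivity, fun n k b J t h₁ h₂ => ?_⟩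
  have hJ := ne_top_of_le_ne_top WithTop.coe_ne_top h₁
  set ρ := rootScale n with hρ
  have hρ0 : 0 < ρ := rootScale_pos n
  have hρ2 : ρ ^ 2 = ((2 : ℝ) ^ n)⁻¹ := rootScale_sq n
  set q := localPosition S n (k * ((2 : ℝ) ^ n)⁻¹) b with hq
  set Λ := Real.log (max B₀ 1 * (1 + (k : ℝ) ^ 2) * 2 ^ n) with hΛ
  set Q := ∑ l ∈ Finset.range J, q l ^ 2 with hQ
  set G := ∑ l ∈ Finset.range J, q l * (skeleton S n (l + 1) - skeleton S n l) with hG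
  have hone : ∀ s : Bool, sgn s * G ≤ 2 * ρ * Λ + ρ * (ρ ^ 2 * Q) := by
    intro s
    have hB := hB₀ (e.symm (n, k, s, b)) J
    simp only [Equiv.apply_symm_apply] at hB
    have hB := hB hJ
    obtain ⟨hpos, hlog⟩ := sum_sub_le_log_prod (abs_bet_le (hbd (n, k, s, b)) hJ)
    have h3 : Real.log (∏ l ∈ Finset.range J,
        (1 + h (n, k, s, b) l S * (skeleton S n (l + 1) - skeleton S n l))) ≤ Λ := by
      refine Real.log_le_log hpos ?_
      rw [← mul_inv, inv_mul_le_iff₀ (by positivity)] at hB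
      refine hB.trans ?_
      calc 2 ^ n * (1 + (k : ℝ) ^ 2) * B₀ ≤ 2 ^ n * (1 + (k : ℝ) ^ 2) * max B₀ 1 :=
            mul_le_mul_of_nonneg_left (le_max_left _ _) (by positivity)
        _ = _ := by ring
    have h4 : ∑ l ∈ Finset.range J, h (n, k, s, b) l S *
        (skeleton S n (l + 1) - skeleton S n l) = ρ⁻¹ / 2 * (sgn s * G) := by
      rw [hG, Finset.mul_sum, Finset.mul_sum]
      exact Finset.sum_congr rfl fun l _ => by simp only [hh]; ring
    have h5 : ∑ l ∈ Finset.range J, (h (n, k, s, b) l S *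
        (skeleton S n (l + 1) - skeleton S n l)) ^ 2 ≤ ρ ^ 2 / 4 * Q := by
      rw [hQ, Finset.mul_sum]
      refine Finset.sum_le_sum fun l hl => ?_
      have h6 := abs_skeleton_succ_sub_le (lebesguePartition_ne_top_of_le hJ (Finset.mem_range.1 hl))
      rw [← hρ2] at h6
      have h7 : (skeleton S n (l + 1) - skeleton S n l) ^ 2 ≤ (ρ ^ 2) ^ 2 := by
        rw [← sq_abs]; exact pow_le_pow_left₀ (abs_nonneg _) h6 2
      have h8 : sgn s ^ 2 = 1 := by rw [← sq_abs, hsgn1]; norm_num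
      calc (h (n, k, s, b) l S * (skeleton S n (l + 1) - skeleton S n l)) ^ 2
          = sgn s ^ 2 * (ρ⁻¹ ^ 2 / 4) * q l ^ 2 * (skeleton S n (l + 1) - skeleton S n l) ^ 2 := by
            simp only [hh]; ring
        _ ≤ sgn s ^ 2 * (ρ⁻¹ ^ 2 / 4) * q l ^ 2 * (ρ ^ 2) ^ 2 :=
            mul_le_mul_of_nonneg_left h7 (by positivity)
        _ = ρ ^ 2 / 4 * q l ^ 2 := by rw [h8]; field_simp
    rw [h4] at hlog
    have h9 : ρ⁻¹ / 2 * (sgn s * G) ≤ Λ + ρ ^ 2 / 2 * Q := by linarith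
    calc sgn s * G = 2 * ρ * (ρ⁻¹ / 2 * (sgn s * G)) := by field_simp
      _ ≤ 2 * ρ * (Λ + ρ ^ 2 / 2 * Q) := mul_le_mul_of_nonneg_left h9 (by positivity)
      _ = _ := by ring
  have hG' : |G| ≤ 2 * ρ * Λ + ρ * (ρ ^ 2 * Q) := by
    have h3 := hone true
    have h4 := hone false
    simp only [hsgn, if_true, Bool.false_eq_true, if_false] at h3 h4
    exact abs_le.2 ⟨by linarith, by linarith⟩
  rw [levelGain_eq h₁ h₂, ← hρ2]
  -- The interval running at time `t` is not covered by the product and is estimated directly.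
  have hlast : |q J * (S t - skeleton S n J)| ≤ ρ ^ 2 := by
    rw [abs_mul, hρ2]
    exact (mul_le_of_le_one_left (abs_nonneg _) (abs_localPosition_le _ _ _ _ _)).trans
      (abs_sub_skeleton_le h₁ h₂)
  refine (abs_add_le _ _).trans ?_
  linarith

/-! ### The martingale part of the discrete local time -/

/-- The gains up to time `t` of the position `1_{S < u}` along the dyadic Lebesgue partition of
level `n`. -/
def belowGain (S : PricePath) (n : ℕ) (t : ℝ≥0) (u : ℝ) : ℝ :=
  levelGain S n (belowIndicator S n u) t

/-- The discrete Tanaka formula. -/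
theorem discreteLocalTime_eq (S : PricePath) (n : ℕ) (t : ℝ≥0) (u : ℝ) :
    discreteLocalTime S (lebesguePartition S n) t u =
      max (u - S t) 0 - max (u - S 0) 0 + belowGain S n t u := by
  obtain ⟨J, h₁, h₂⟩ := exists_lebesguePartition_le_lt S n t
  -- Tanaka's formula for a single step, by the position of both endpoints relative to `u`.
  have hstep : ∀ a b : ℝ, (Set.uIoc a b).indicator (fun v => |b - v|) u =
      max (u - b) 0 - max (u - a) 0 + (if a < u then 1 else 0) * (b - a) := by
    intro a b
    by_cases ha : a < u <;> by_cases hb : b < u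
    · rw [Set.indicator_of_notMem (by rw [Set.mem_uIoc]; push Not; exact ⟨fun _ => hb, fun _ => ha⟩),
        if_pos ha, max_eq_left (by linarith), max_eq_left (by linarith)]
      ring
    · push Not at hb
      rw [Set.indicator_of_mem (Set.mem_uIoc.2 (Or.inl ⟨ha, hb⟩)), if_pos ha,
        abs_of_nonneg (by linarith), max_eq_right (by linarith), max_eq_left (by linarith)]
      ring
    · push Not at ha
      rw [Set.indicator_of_mem (Set.mem_uIoc.2 (Or.inr ⟨hb, ha⟩)), if_neg (by linarith),
        abs_of_nonpos (by linarith), max_eq_left (by linarith), max_eq_right (by linarith)]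
      ring
    · push Not at ha hb
      rw [Set.indicator_of_notMem (by
          rw [Set.mem_uIoc]; push Not; exact ⟨fun h => by linarith, fun h => by linarith⟩),
        if_neg (by linarith), max_eq_right (by linarith), max_eq_right (by linarith)]
      ring
  have h3 := tsum_partition_eq h₁ h₂.le
    (fun _ a b => (Set.uIoc a b).indicator (fun v => |b - v|) u) (by simp)
  rw [discreteLocalTime, h3, belowGain, levelGain_eq h₁ h₂.le]
  simp only [hstep, belowIndicator, Finset.sum_add_distrib]
  rw [Finset.sum_range_sub (fun k => max (u - skeleton S n k) 0), skeleton_zero]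
  ring

/-- Positions that vanish after the first interval have small gains. -/
theorem abs_levelGain_le_of_eq_zero {S : PricePath} {n : ℕ} {F : ℕ → ℝ} {t : ℝ≥0}
    (hF : ∀ l, lebesguePartition S n (l + 1) ≠ ⊤ → F (l + 1) = 0) :
    |levelGain S n F t| ≤ |F 0| * ((2 : ℝ) ^ n)⁻¹ := by
  obtain ⟨J, h₁, h₂⟩ := exists_lebesguePartition_le_lt S n t
  have hJ := ne_top_of_le_ne_top WithTop.coe_ne_top h₁
  rw [levelGain_eq h₁ h₂.le]
  rcases J with _ | J
  · simp only [Finset.range_zero, Finset.sum_empty, zero_add, abs_mul]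
    exact mul_le_mul_of_nonneg_left (abs_sub_skeleton_le h₁ h₂.le) (abs_nonneg _)
  · rw [hF J hJ, zero_mul, add_zero, Finset.sum_range_succ', Finset.sum_eq_zero, zero_add, abs_mul]
    · exact mul_le_mul_of_nonneg_left (abs_skeleton_succ_sub_le
        (lebesguePartition_ne_top_of_le hJ (by omega))) (abs_nonneg _)
    · intro l hl
      rw [hF l (lebesguePartition_ne_top_of_le hJ (by simp at hl; omega)), zero_mul]

theorem belowGain_sub (S : PricePath) (n : ℕ) (t : ℝ≥0) (u v : ℝ) :
    belowGain S n t u - belowGain S n t v =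
      levelGain S n (belowIndicator S n u - belowIndicator S n v) t := by
  rw [levelGain_sub]; rfl

theorem lt_iff_lt_ceil {n : ℕ} {x u : ℝ} (hx : x ∈ dyadicGrid n) :
    x < u ↔ x < ⌈u * 2 ^ n⌉ * ((2 : ℝ) ^ n)⁻¹ := by
  obtain ⟨m, rfl⟩ := hx
  have hpos : (0 : ℝ) < 2 ^ n := by positivity
  rw [← div_eq_mul_inv, ← div_eq_mul_inv, div_lt_div_iff_of_pos_right hpos, Int.cast_lt,
    Int.lt_ceil, div_lt_iff₀ hpos]

/-- `belowGain` depends on the space variable only through its cell in the dyadic grid, up to the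
contribution of the first interval. -/
theorem abs_belowGain_sub_le_of_ceil_eq {S : PricePath} {n m : ℕ} (hmn : m ≤ n) {t : ℝ≥0}
    {u v : ℝ} (h : ⌈u * 2 ^ n⌉ = ⌈v * 2 ^ n⌉) :
    |belowGain S m t u - belowGain S m t v| ≤
      |belowIndicator S m u 0 - belowIndicator S m v 0| * ((2 : ℝ) ^ m)⁻¹ := by
  rw [belowGain_sub]
  refine abs_levelGain_le_of_eq_zero fun l hl => ?_
  have hmem := dyadicGrid_mono hmn (skeleton_succ_mem hl)
  simp only [Pi.sub_apply, belowIndicator, lt_iff_lt_ceil (u := u) hmem,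
    lt_iff_lt_ceil (u := v) hmem, h, sub_self]

theorem abs_belowIndicator_sub_le (S : PricePath) (n l : ℕ) (u v : ℝ) :
    |belowIndicator S n u l - belowIndicator S n v l| ≤ 1 := by
  simp only [belowIndicator]; split_ifs <;> simp

theorem abs_belowGain_sub_ceil_le (S : PricePath) {n m : ℕ} (hmn : m ≤ n) (t : ℝ≥0) (u : ℝ) :
    |belowGain S m t u - belowGain S m t (⌈u * 2 ^ n⌉ * ((2 : ℝ) ^ n)⁻¹)| ≤ ((2 : ℝ) ^ m)⁻¹ := by
  refine (abs_belowGain_sub_le_of_ceil_eq hmn ?_).trans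
    (mul_le_of_le_one_left (by positivity) (abs_belowIndicator_sub_le _ _ _ _ _))
  rw [inv_mul_cancel_right₀ (by positivity), Int.ceil_intCast]

/-- For a grid value `x`, being below `(k + 1) 2⁻ⁿ` but not below `k 2⁻ⁿ` means `x = k 2⁻ⁿ`. Only
the starting value, possibly off the grid, breaks this, and it affects one interval. -/
theorem abs_belowGain_succ_sub_le (S : PricePath) (n : ℕ) (t : ℝ≥0) (k : ℤ) :
    |belowGain S n t ((k + 1 : ℤ) * ((2 : ℝ) ^ n)⁻¹) - belowGain S n t (k * ((2 : ℝ) ^ n)⁻¹) -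
      levelGain S n (visitIndicator S n (k * ((2 : ℝ) ^ n)⁻¹)) t| ≤ ((2 : ℝ) ^ n)⁻¹ := by
  rw [belowGain_sub, ← levelGain_sub]
  have hpos : (0 : ℝ) < ((2 : ℝ) ^ n)⁻¹ := by positivity
  have h01 : k * ((2 : ℝ) ^ n)⁻¹ < (k + 1 : ℤ) * ((2 : ℝ) ^ n)⁻¹ := by
    push_cast; nlinarith
  refine (abs_levelGain_le_of_eq_zero fun l hl => ?_).trans
    (mul_le_of_le_one_left hpos.le ?_)
  · obtain ⟨m, hm⟩ := skeleton_succ_mem hl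
    simp only [Pi.sub_apply, belowIndicator, visitIndicator, hm, mul_lt_mul_iff_left₀ hpos,
      Int.cast_lt, mul_left_inj' hpos.ne', Int.cast_inj]
    rcases lt_trichotomy m k with h | h | h
    · rw [if_pos (by omega), if_pos h, if_neg (by omega)]; norm_num
    · rw [if_pos (by omega), if_neg (by omega), if_pos h]; norm_num
    · rw [if_neg (by omega), if_neg (by omega), if_neg (by omega)]; norm_num
  · simp only [Pi.sub_apply, belowIndicator, visitIndicator]
    split_ifs <;> first | (exfalso; linarith) | norm_num

/-! ### A priori bounds on a time interval where the path stays in `[-R, R]`. -/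

section Bounded

variable {S : PricePath} {T : ℝ≥0} {R : ℝ}

theorem abs_skeleton_le (hR : ∀ t ≤ T, |S t| ≤ R) {n J : ℕ} {t : ℝ≥0} (ht : t ≤ T)
    (h₁ : lebesguePartition S n J ≤ (t : WithTop ℝ≥0)) : |skeleton S n J| ≤ R := by
  obtain ⟨r, hr⟩ := WithTop.ne_top_iff_exists.1 (ne_top_of_le_ne_top WithTop.coe_ne_top h₁)
  rw [skeleton_eq hr.symm]
  exact hR r ((WithTop.coe_le_coe.1 (hr ▸ h₁)).trans ht)

theorem levelGain_one (S : PricePath) (n : ℕ) (t : ℝ≥0) :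
    levelGain S n (fun _ => 1) t = S t - S 0 := by
  obtain ⟨J, h₁, h₂⟩ := exists_lebesguePartition_le_lt S n t
  rw [levelGain_eq h₁ h₂.le]
  simp only [one_mul]
  rw [Finset.sum_range_sub (fun k => skeleton S n k), skeleton_zero]; ring

theorem levelGain_congr {n J : ℕ} {t : ℝ≥0} {F G : ℕ → ℝ}
    (h₁ : lebesguePartition S n J ≤ (t : WithTop ℝ≥0))
    (h₂ : (t : WithTop ℝ≥0) ≤ lebesguePartition S n (J + 1))
    (h : ∀ l ≤ J, F l = G l) : levelGain S n F t = levelGain S n G t := by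
  rw [levelGain_eq h₁ h₂, levelGain_eq h₁ h₂, h J le_rfl]
  congr 1
  exact Finset.sum_congr rfl fun l hl => by rw [h l (Finset.mem_range.1 hl).le]

/-- Together with `belowGain_of_le` this makes `belowGain` trivial outside the range of the path, so
that only grid points in a bounded interval, with controlled weights, have to be estimated. -/
theorem belowGain_of_lt (hR : ∀ t ≤ T, |S t| ≤ R) (n : ℕ) {t : ℝ≥0} (ht : t ≤ T) {u : ℝ}
    (hu : R < u) : belowGain S n t u = S t - S 0 := by
  obtain ⟨J, h₁, h₂⟩ := exists_lebesguePartition_le_lt S n t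
  rw [← levelGain_one S n t, belowGain]
  refine levelGain_congr h₁ h₂.le fun l hl => ?_
  have := abs_skeleton_le hR ht ((lebesguePartition_mono S n hl).trans h₁)
  exact if_pos (by linarith [(abs_le.1 this).2])

theorem belowGain_of_le (hR : ∀ t ≤ T, |S t| ≤ R) (n : ℕ) {t : ℝ≥0} (ht : t ≤ T) {u : ℝ}
    (hu : u ≤ -R) : belowGain S n t u = 0 := by
  obtain ⟨J, h₁, h₂⟩ := exists_lebesguePartition_le_lt S n t
  have h0 : levelGain S n (fun _ => 0) t = 0 := by simp [levelGain]
  rw [← h0, belowGain]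
  refine levelGain_congr h₁ h₂.le fun l hl => ?_
  have := abs_skeleton_le hR ht ((lebesguePartition_mono S n hl).trans h₁)
  exact if_neg (by linarith [(abs_le.1 this).1])

/-- The number of visits of a grid point is controlled by `belowGain`. -/
theorem visits_le (hR : ∀ t ≤ T, |S t| ≤ R) {n : ℕ} {m : ℝ}
    (hm : ∀ t ≤ T, ∀ u, |belowGain S n t u| ≤ m) {J : ℕ} {t : ℝ≥0} (ht : t ≤ T)
    (h₁ : lebesguePartition S n J ≤ (t : WithTop ℝ≥0)) (k : ℤ) :
    ((2 : ℝ) ^ n)⁻¹ * ∑ l ∈ Finset.range J, visitIndicator S n (k * ((2 : ℝ) ^ n)⁻¹) l ≤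
      4 * R + 4 * m + 1 := by
  set d := k * ((2 : ℝ) ^ n)⁻¹ with hd
  have hJ := ne_top_of_le_ne_top WithTop.coe_ne_top h₁
  obtain ⟨r, hr⟩ := WithTop.ne_top_iff_exists.1 hJ
  have hrT : r ≤ T := (WithTop.coe_le_coe.1 (hr ▸ h₁)).trans ht
  -- The combined position `-1 + 2 · 1_{x < d} + 1_{x = d}` is minus the sign of `x - d`. Convexity
  -- of `|x - d|` makes the right side nonnegative, and at a visit it equals the distance to the
  -- next grid value, at least `2⁻ⁿ`.
  have hstep : ∀ l ∈ Finset.range J, ((2 : ℝ) ^ n)⁻¹ * visitIndicator S n d l ≤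
      (|skeleton S n (l + 1) - d| - |skeleton S n l - d|) -
      (skeleton S n (l + 1) - skeleton S n l) +
      2 * (belowIndicator S n d l * (skeleton S n (l + 1) - skeleton S n l)) +
      visitIndicator S n d l * (skeleton S n (l + 1) - skeleton S n l) := by
    intro l hl
    have hl' := lebesguePartition_ne_top_of_le hJ (Finset.mem_range.1 hl : l + 1 ≤ J)
    simp only [visitIndicator, belowIndicator]
    rcases lt_trichotomy (skeleton S n l) d with h | h | h
    · rw [if_neg h.ne, if_pos h, abs_of_neg (a := skeleton S n l - d) (by linarith)]
      linarith [neg_abs_le (skeleton S n (l + 1) - d)]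
    · rw [if_pos h, if_neg (by linarith)]
      have h3 := le_abs_sub_of_mem_dyadicGrid (skeleton_succ_mem hl') ⟨k, rfl⟩
        (by rw [← hd, ← h]; exact skeleton_succ_ne hl')
      rw [← hd] at h3
      rw [h, sub_self, abs_zero]
      linarith
    · rw [if_neg h.ne', if_neg (by linarith),
        abs_of_pos (a := skeleton S n l - d) (by linarith)]
      linarith [le_abs_self (skeleton S n (l + 1) - d)]
  have hsum := Finset.sum_le_sum hstep
  rw [← Finset.mul_sum] at hsum
  simp only [Finset.sum_add_distrib, Finset.sum_sub_distrib, ← Finset.mul_sum] at hsum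
  have htel1 := Finset.sum_range_sub (fun l => |skeleton S n l - d|) J
  have htel2 := Finset.sum_range_sub (fun l => skeleton S n l) J
  rw [Finset.sum_sub_distrib] at htel1 htel2
  have hrle := lebesguePartition_le_succ S n J
  -- Evaluating at `r`, the `J`-th partition point, removes the running interval.
  have hg1 : belowGain S n r d =
      ∑ l ∈ Finset.range J, belowIndicator S n d l * (skeleton S n (l + 1) - skeleton S n l) := by
    rw [belowGain, levelGain_eq hr.ge (hr ▸ hrle), skeleton_eq hr.symm, sub_self, mul_zero,
      add_zero]
  have hg2 : levelGain S n (visitIndicator S n d) r =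
      ∑ l ∈ Finset.range J, visitIndicator S n d l * (skeleton S n (l + 1) - skeleton S n l) := by
    rw [levelGain_eq hr.ge (hr ▸ hrle), skeleton_eq hr.symm, sub_self, mul_zero, add_zero]
  rw [htel1, htel2, ← hg1, ← hg2] at hsum
  have h4 := abs_belowGain_succ_sub_le S n r k
  rw [← hd] at h4
  have h5 := hm r hrT d
  have h6 := hm r hrT ((k + 1 : ℤ) * ((2 : ℝ) ^ n)⁻¹)
  have h7 := abs_skeleton_le hR ht h₁
  have h8 : |skeleton S n 0| ≤ R := by rw [skeleton_zero]; exact hR 0 bot_le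
  have h9 : ((2 : ℝ) ^ n)⁻¹ ≤ 1 := inv_le_one_of_one_le₀ (one_le_pow₀ (by norm_num))
  have h10 := abs_sub_abs_le_abs_sub (skeleton S n J - d) (skeleton S n 0 - d)
  have h11 : |skeleton S n J - d - (skeleton S n 0 - d)| ≤ 2 * R := by
    rw [sub_sub_sub_cancel_right]
    exact (abs_sub _ _).trans (by linarith)
  have := abs_le.1 h4; have := abs_le.1 h5; have := abs_le.1 h6; have := abs_le.1 h7
  have := abs_le.1 h8
  linarith

/-- The squared change of `belowIndicator` between two levels is carried by few grid points. -/
theorem sq_localPosition_true_le {n : ℕ} (k : ℤ) {l : ℕ} (hl : lebesguePartition S n l ≠ ⊤) :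
    localPosition S n (k * ((2 : ℝ) ^ n)⁻¹) true l ^ 2 ≤
      ∑ i ∈ Finset.Icc (-2 : ℤ) 2, visitIndicator S n ((k + i : ℤ) * ((2 : ℝ) ^ n)⁻¹) l := by
  set h := ((2 : ℝ) ^ n)⁻¹ with hh
  have hpos : 0 < h := by positivity
  have hnonneg : ∀ i ∈ Finset.Icc (-2 : ℤ) 2, 0 ≤ visitIndicator S n ((k + i : ℤ) * h) l := by
    intro i _; rw [visitIndicator]; split_ifs <;> norm_num
  by_cases hq : localPosition S n (k * h) true l = 0
  · rw [hq]; simpa using Finset.sum_nonneg hnonneg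
  have hq1 : localPosition S n (k * h) true l ^ 2 ≤ 1 := by
    rw [← sq_abs]
    exact pow_le_one₀ (abs_nonneg _) (abs_localPosition_le _ _ _ _ _)
  rcases l with _ | l
  · refine absurd ?_ hq
    simp only [localPosition, coarseIndex, belowIndicator, skeleton_zero]
    exact sub_self _
  obtain ⟨j, hj⟩ := skeleton_succ_mem hl
  set X := skeleton S (n - 1) (coarseIndex S (n - 1) n (l + 1)) with hX
  obtain ⟨t, ht⟩ := WithTop.ne_top_iff_exists.1 hl
  obtain ⟨h1, h2⟩ := coarseIndex_spec (Nat.sub_le n 1) hl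
  have hclose : |skeleton S n (l + 1) - X| ≤ 2 * h := by
    rw [skeleton_eq ht.symm]
    refine (abs_sub_skeleton_le (ht ▸ h1) (ht ▸ h2.le)).trans ?_
    rw [hh]
    rcases n with _ | n
    · norm_num
    · rw [Nat.add_sub_cancel, pow_succ, mul_inv]; linarith
  -- The two indicators differ only if `k * h` separates the fine value from the coarse one, and
  -- these are within the coarse mesh `2 * h`.
  have habs : |skeleton S n (l + 1) - k * h| ≤ 2 * h := by
    simp only [localPosition, belowIndicator] at hq
    rw [abs_le] at hclose ⊢
    split_ifs at hq with ha hb hb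
    · exact absurd (sub_self _) hq
    · constructor <;> linarith
    · constructor <;> linarith
    · exact absurd (sub_self _) hq
  rw [hj, ← hh, ← sub_mul, abs_mul, abs_of_pos hpos, mul_le_mul_iff_left₀ hpos] at habs
  have habs' : |j - k| ≤ 2 := by exact_mod_cast habs
  have hmem : j - k ∈ Finset.Icc (-2 : ℤ) 2 := by
    rw [Finset.mem_Icc]; exact abs_le.1 habs'
  refine hq1.trans ?_
  refine le_trans ?_ (Finset.single_le_sum hnonneg hmem)
  rw [visitIndicator, if_pos (by rw [hj, add_sub_cancel])]

/-- A crude bound, depending on the level through the number of intervals. It only ensures that the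
suprema entering the recursion are finite. -/
theorem exists_belowGain_bound (S : PricePath) (T : ℝ≥0) (n : ℕ) :
    ∃ m, ∀ t ≤ T, ∀ u, |belowGain S n t u| ≤ m := by
  obtain ⟨J, h₁, h₂⟩ := exists_lebesguePartition_le_lt S n T
  refine ⟨(J + 1) * ((2 : ℝ) ^ n)⁻¹, fun t ht u => ?_⟩
  obtain ⟨I, h₃, h₄⟩ := exists_lebesguePartition_le_lt S n t
  have hIJ : I ≤ J := by
    by_contra hlt
    have h5 := h₂.trans_le (lebesguePartition_mono S n (by omega : J + 1 ≤ I))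
    exact absurd (h₃.trans (WithTop.coe_le_coe.2 ht)) (not_le.2 h5)
  have hI := ne_top_of_le_ne_top WithTop.coe_ne_top h₃
  have hb : ∀ l, |belowIndicator S n u l| ≤ 1 := fun l => by
    rw [belowIndicator]; split_ifs <;> simp
  rw [belowGain, levelGain_eq h₃ h₄.le]
  calc |_ + _| ≤ |∑ l ∈ Finset.range I, _| + |_| := abs_add_le _ _
    _ ≤ ∑ l ∈ Finset.range I, ((2 : ℝ) ^ n)⁻¹ + ((2 : ℝ) ^ n)⁻¹ := by
        refine add_le_add ((Finset.abs_sum_le_sum_abs _ _).trans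
          (Finset.sum_le_sum fun l hl => ?_)) ?_
        · rw [abs_mul]
          exact (mul_le_of_le_one_left (abs_nonneg _) (hb l)).trans (abs_skeleton_succ_sub_le
            (lebesguePartition_ne_top_of_le hI (Finset.mem_range.1 hl)))
        · rw [abs_mul]
          exact (mul_le_of_le_one_left (abs_nonneg _) (hb I)).trans (abs_sub_skeleton_le h₃ h₄.le)
    _ = (I + 1) * ((2 : ℝ) ^ n)⁻¹ := by simp; ring
    _ ≤ (J + 1) * ((2 : ℝ) ^ n)⁻¹ := by gcongr

end Bounded

/-! ### Uniform estimates -/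

/-- For grid points in a bounded range `k ^ 2` is of order `4 ^ n`, so the inverse weight is at most
a constant times `8 ^ n`. -/
theorem log_weight_le {B R : ℝ} (hB : 0 < B) (hR : 0 ≤ R) {n : ℕ} {k : ℤ}
    (hk : |k * ((2 : ℝ) ^ n)⁻¹| ≤ R + 1) :
    Real.log (B * (1 + (k : ℝ) ^ 2) * 2 ^ n) ≤ |Real.log (B * (1 + (R + 1) ^ 2))| + 3 * n := by
  have hpos : (0 : ℝ) < 2 ^ n := by positivity
  have hk2 : (k : ℝ) ^ 2 ≤ (R + 1) ^ 2 * (2 ^ n) ^ 2 := by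
    rw [abs_mul, abs_of_pos (inv_pos.2 hpos), ← div_eq_mul_inv, div_le_iff₀ hpos] at hk
    rw [← sq_abs, ← mul_pow]
    exact pow_le_pow_left₀ (abs_nonneg _) hk 2
  have h1 : 1 + (k : ℝ) ^ 2 ≤ (1 + (R + 1) ^ 2) * (2 ^ n) ^ 2 := by
    have : (1 : ℝ) ≤ (2 ^ n) ^ 2 := one_le_pow₀ (one_le_pow₀ (by norm_num))
    linarith
  have h2 : B * (1 + (k : ℝ) ^ 2) * 2 ^ n ≤ B * (1 + (R + 1) ^ 2) * 8 ^ n := by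
    calc B * (1 + (k : ℝ) ^ 2) * 2 ^ n ≤ B * ((1 + (R + 1) ^ 2) * (2 ^ n) ^ 2) * 2 ^ n := by
          gcongr
      _ = B * (1 + (R + 1) ^ 2) * 8 ^ n := by
          have h8 : (8 : ℝ) ^ n = (2 ^ n) ^ 2 * 2 ^ n := by
            rw [← pow_succ, ← pow_mul, mul_comm, pow_mul]; norm_num
          rw [h8]; ring
  refine (Real.log_le_log (by positivity) h2).trans ?_
  rw [Real.log_mul (by positivity) (by positivity), Real.log_pow]
  have h8 : Real.log 8 ≤ 3 := by
    rw [show (8 : ℝ) = 2 ^ 3 by norm_num, Real.log_pow]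
    have := Real.log_two_lt_d9
    push_cast; linarith
  have : (n : ℝ) * Real.log 8 ≤ n * 3 := mul_le_mul_of_nonneg_left h8 (Nat.cast_nonneg n)
  linarith [le_abs_self (Real.log (B * (1 + (R + 1) ^ 2)))]

theorem rootScale_sq_le (n : ℕ) : rootScale n ^ 2 ≤ rootScale n := by
  nlinarith [rootScale_pos n, rootScale_le_one n]

/-- The exponential inequality combined with the visit count. The constant is independent of `n` and
`m`, and `m` enters linearly; this is what a Gronwall argument needs. -/
theorem exists_level_estimates {S : PricePath} {T : ℝ≥0} {R B : ℝ} (hR : ∀ t ≤ T, |S t| ≤ R)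
    (hB : 0 < B) (hS : LocalGainBound S B) :
    ∃ C : ℝ, 0 ≤ C ∧ ∀ (n : ℕ) (m : ℝ), (∀ t ≤ T, ∀ u, |belowGain S n t u| ≤ m) →
      (∀ t ≤ T, ∀ k : ℤ, |belowGain S n t ((k + 1 : ℤ) * ((2 : ℝ) ^ n)⁻¹) -
        belowGain S n t (k * ((2 : ℝ) ^ n)⁻¹)| ≤ C * (rootScale n * (n + 1)) * (1 + m)) ∧
      ∀ t ≤ T, ∀ u, |belowGain S n t u - belowGain S (n - 1) t u| ≤
        C * (rootScale n * (n + 1)) * (1 + m) := by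
  have hR0 : 0 ≤ R := (abs_nonneg _).trans (hR 0 bot_le)
  set c := |Real.log (B * (1 + (R + 1) ^ 2))| with hc
  have hc0 : 0 ≤ c := abs_nonneg _
  refine ⟨50 + 2 * c + 20 * R, by positivity, fun n m hm => ?_⟩
  have hm0 : 0 ≤ m := (abs_nonneg _).trans (hm 0 bot_le 0)
  set ρ := rootScale n with hρ
  have hρ0 : 0 < ρ := rootScale_pos n
  have hρ1 : ρ ^ 2 ≤ ρ := rootScale_sq_le n
  have hρ2 : ρ ^ 2 = ((2 : ℝ) ^ n)⁻¹ := rootScale_sq n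
  have hn0 : (0 : ℝ) ≤ n := Nat.cast_nonneg n
  -- The worst case collects three rounding errors, the logarithm of the weight, and the visits of
  -- five neighbouring grid points.
  have hbound : ∀ x : ℝ, x ≤ 9 + 2 * c + 6 * n + 20 * R + 20 * m →
      ρ * x ≤ (50 + 2 * c + 20 * R) * (ρ * (n + 1)) * (1 + m) := by
    intro x hx
    have h1 : x ≤ (50 + 2 * c + 20 * R) * ((n + 1) * (1 + m)) := by
      have h2 : 1 + n + m ≤ ((n : ℝ) + 1) * (1 + m) := by nlinarith
      have h3 : (50 + 2 * c + 20 * R) * (1 + n + m) ≤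
          (50 + 2 * c + 20 * R) * ((n + 1) * (1 + m)) :=
        mul_le_mul_of_nonneg_left h2 (by positivity)
      nlinarith [mul_nonneg hc0 hn0, mul_nonneg hc0 hm0, mul_nonneg hR0 hn0, mul_nonneg hR0 hm0]
    calc ρ * x ≤ ρ * ((50 + 2 * c + 20 * R) * ((n + 1) * (1 + m))) :=
          mul_le_mul_of_nonneg_left h1 hρ0.le
      _ = _ := by ring
  have hrhs : 0 ≤ (50 + 2 * c + 20 * R) * (ρ * (n + 1)) * (1 + m) := by positivity
  have hh1 : ((2 : ℝ) ^ n)⁻¹ ≤ 1 := inv_le_one_of_one_le₀ (one_le_pow₀ (by norm_num))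
  -- The margin `1` ensures that the neighbouring grid point `k + 1` is outside the range of the
  -- path as well.
  have hout : ∀ k : ℤ, ¬ |k * ((2 : ℝ) ^ n)⁻¹| ≤ R + 1 →
      R + 1 < k * ((2 : ℝ) ^ n)⁻¹ ∨ k * ((2 : ℝ) ^ n)⁻¹ < -(R + 1) := by
    intro k hk
    rw [abs_le, not_and_or] at hk
    push Not at hk
    exact hk.symm
  constructor
  · intro t ht k
    by_cases hk : |k * ((2 : ℝ) ^ n)⁻¹| ≤ R + 1
    · obtain ⟨J, h₁, h₂⟩ := exists_lebesguePartition_le_lt S n t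
      have h3 := hS n k false J t h₁ h₂.le
      have h4 : ∑ l ∈ Finset.range J, localPosition S n (k * ((2 : ℝ) ^ n)⁻¹) false l ^ 2 =
          ∑ l ∈ Finset.range J, visitIndicator S n (k * ((2 : ℝ) ^ n)⁻¹) l :=
        Finset.sum_congr rfl fun l _ => by
          simp only [localPosition, visitIndicator]; split_ifs <;> norm_num
      rw [h4] at h3
      have h5 := abs_belowGain_succ_sub_le S n t k
      have h6 := visits_le hR hm ht h₁ k
      have h7 := log_weight_le hB hR0 hk
      rw [← hc] at h7
      rw [← hρ, ← hρ2] at h3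
      rw [← hρ2] at h5 h6 ⊢
      have h8 := abs_sub_abs_le_abs_sub (belowGain S n t ((k + 1 : ℤ) * ρ ^ 2) -
        belowGain S n t (k * ρ ^ 2)) (levelGain S n (visitIndicator S n (k * ρ ^ 2)) t)
      simp only [localPosition] at h3
      refine le_trans ?_ (hbound (2 + 2 * (c + 3 * n) + (4 * R + 4 * m + 1)) (by linarith))
      have h9 := mul_le_mul_of_nonneg_left h7 (by positivity : 0 ≤ 2 * ρ)
      have h10 := mul_le_mul_of_nonneg_left h6 hρ0.le
      linarith
    · have hpos : (0 : ℝ) < ((2 : ℝ) ^ n)⁻¹ := by positivity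
      rcases hout k hk with h | h
      · rw [belowGain_of_lt hR n ht (by push_cast; linarith),
          belowGain_of_lt hR n ht (by linarith), sub_self, abs_zero]
        exact hrhs
      · rw [belowGain_of_le hR n ht (by push_cast; linarith),
          belowGain_of_le hR n ht (by linarith), sub_self, abs_zero]
        exact hrhs
  · intro t ht u
    have hgrid : ∀ k : ℤ, |belowGain S n t (k * ((2 : ℝ) ^ n)⁻¹) -
        belowGain S (n - 1) t (k * ((2 : ℝ) ^ n)⁻¹)| ≤
        ρ * (1 + 2 * (c + 3 * n) + 5 * (4 * R + 4 * m + 1)) := by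
      intro k
      by_cases hk : |k * ((2 : ℝ) ^ n)⁻¹| ≤ R + 1
      · obtain ⟨J, h₁, h₂⟩ := exists_lebesguePartition_le_lt S n t
        have hJ := ne_top_of_le_ne_top WithTop.coe_ne_top h₁
        have h3 := hS n k true J t h₁ h₂.le
        have h4 : belowGain S n t (k * ((2 : ℝ) ^ n)⁻¹) -
            belowGain S (n - 1) t (k * ((2 : ℝ) ^ n)⁻¹) =
            levelGain S n (localPosition S n (k * ((2 : ℝ) ^ n)⁻¹) true) t := by
          rw [belowGain, belowGain, ← levelGain_coarseIndex S (Nat.sub_le n 1), ← levelGain_sub]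
          rfl
        have h5 : ((2 : ℝ) ^ n)⁻¹ *
            ∑ l ∈ Finset.range J, localPosition S n (k * ((2 : ℝ) ^ n)⁻¹) true l ^ 2 ≤
            5 * (4 * R + 4 * m + 1) := by
          calc ((2 : ℝ) ^ n)⁻¹ *
              ∑ l ∈ Finset.range J, localPosition S n (k * ((2 : ℝ) ^ n)⁻¹) true l ^ 2
              ≤ ((2 : ℝ) ^ n)⁻¹ * ∑ l ∈ Finset.range J, ∑ i ∈ Finset.Icc (-2 : ℤ) 2,
                visitIndicator S n ((k + i : ℤ) * ((2 : ℝ) ^ n)⁻¹) l := by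
                refine mul_le_mul_of_nonneg_left (Finset.sum_le_sum fun l hl => ?_)
                  (by positivity)
                exact sq_localPosition_true_le k
                  (lebesguePartition_ne_top_of_le hJ (Finset.mem_range.1 hl).le)
            _ = ∑ i ∈ Finset.Icc (-2 : ℤ) 2, ((2 : ℝ) ^ n)⁻¹ * ∑ l ∈ Finset.range J,
                visitIndicator S n ((k + i : ℤ) * ((2 : ℝ) ^ n)⁻¹) l := by
                rw [Finset.sum_comm, Finset.mul_sum]
            _ ≤ ∑ i ∈ Finset.Icc (-2 : ℤ) 2, (4 * R + 4 * m + 1) :=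
                Finset.sum_le_sum fun i _ => visits_le hR hm ht h₁ (k + i)
            _ = 5 * (4 * R + 4 * m + 1) := by
                rw [Finset.sum_const, nsmul_eq_mul]; rfl
        have h7 := log_weight_le hB hR0 hk
        rw [← hc] at h7
        rw [h4]
        have h9 := mul_le_mul_of_nonneg_left h7 (by positivity : 0 ≤ 2 * ρ)
        have h10 := mul_le_mul_of_nonneg_left h5 hρ0.le
        rw [← hρ] at h3
        linarith
      · have hrhs' : 0 ≤ ρ * (1 + 2 * (c + 3 * n) + 5 * (4 * R + 4 * m + 1)) := by positivity
        rcases hout k hk with h | h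
        · rw [belowGain_of_lt hR n ht (by linarith), belowGain_of_lt hR _ ht (by linarith),
            sub_self, abs_zero]
          exact hrhs'
        · rw [belowGain_of_le hR n ht (by linarith), belowGain_of_le hR _ ht (by linarith),
            sub_self, abs_zero]
          exact hrhs'
    -- A general `u` is rounded up to the level-`n` grid, at cost `2⁻ⁿ` at level `n` and at most `2
    -- · 2⁻ⁿ` at the coarser level.
    have h1 := abs_belowGain_sub_ceil_le S (le_refl n) t u
    have h2 := abs_belowGain_sub_ceil_le S (Nat.sub_le n 1) t u
    have h3 := hgrid ⌈u * 2 ^ n⌉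
    have h4 : ((2 : ℝ) ^ (n - 1))⁻¹ ≤ 2 * ((2 : ℝ) ^ n)⁻¹ := by
      rcases n with _ | n
      · norm_num
      · rw [Nat.add_sub_cancel, pow_succ, mul_inv]; linarith
    refine le_trans ?_ (hbound (3 + (1 + 2 * (c + 3 * n) + 5 * (4 * R + 4 * m + 1)))
      (by linarith))
    rw [← hρ2] at h1 h2 h3 h4
    rw [abs_le] at h1 h2 h3 ⊢
    constructor <;> linarith

theorem summable_rootScale_mul : Summable fun n : ℕ => rootScale n * (n + 1) := by
  have hlt : ‖(√2)⁻¹‖ < 1 := by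
    rw [norm_inv, Real.norm_of_nonneg (Real.sqrt_nonneg 2)]
    exact inv_lt_one_of_one_lt₀ (by rw [Real.lt_sqrt] <;> norm_num)
  have h1 := summable_pow_mul_geometric_of_norm_lt_one 1 hlt
  have h2 := summable_geometric_of_norm_lt_one hlt
  refine (h1.add h2).congr fun n => ?_
  rw [rootScale, inv_pow]; ring

/-- An implicit discrete Gronwall inequality. Once `ε n ≤ 1/2` the next term can be solved for, at
the price of a factor `exp (2 * ε n)`; the product of these factors converges, and finitely many
initial terms are harmless. -/
theorem bddAbove_of_le_add_mul {a ε : ℕ → ℝ} (ha : ∀ n, 0 ≤ a n) (hε : ∀ n, 0 ≤ ε n)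
    (hsum : Summable ε) (h : ∀ n, a (n + 1) ≤ a n + ε n * (1 + a (n + 1))) :
    ∃ M, ∀ n, a n ≤ M := by
  obtain ⟨n₀, hn₀⟩ := eventually_atTop.1
    (hsum.tendsto_atTop_zero.eventually (ge_mem_nhds (by norm_num : (0 : ℝ) < 1 / 2)))
  have hstep : ∀ n ≥ n₀, 1 + a (n + 1) ≤ (1 + a n) * Real.exp (2 * ε n) := by
    intro n hn
    have h1 : (1 + a (n + 1)) * (1 - ε n) ≤ 1 + a n := by linarith [h n]
    have h2 : 1 + a (n + 1) ≤ (1 + a n) * (1 + 2 * ε n) := by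
      -- The difference of the two sides is `ε n * (1 - 2 * ε n)`.
      have h3 : 1 ≤ (1 - ε n) * (1 + 2 * ε n) := by nlinarith [hn₀ n hn, hε n]
      calc 1 + a (n + 1) ≤ (1 + a (n + 1)) * ((1 - ε n) * (1 + 2 * ε n)) :=
            le_mul_of_one_le_right (by linarith [ha (n + 1)]) h3
        _ = (1 + a (n + 1)) * (1 - ε n) * (1 + 2 * ε n) := by ring
        _ ≤ _ := mul_le_mul_of_nonneg_right h1 (by linarith [hε n])
    refine h2.trans (mul_le_mul_of_nonneg_left ?_ (by linarith [ha n]))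
    linarith [Real.add_one_le_exp (2 * ε n)]
  have hind : ∀ n ≥ n₀, 1 + a n ≤ (1 + a n₀) * Real.exp (2 * ∑ i ∈ Finset.range n, ε i) := by
    intro n hn
    induction n, hn using Nat.le_induction with
    | base =>
      refine le_mul_of_one_le_right (by linarith [ha n₀]) (Real.one_le_exp ?_)
      exact mul_nonneg (by norm_num) (Finset.sum_nonneg fun i _ => hε i)
    | succ n hn ih =>
      refine (hstep n hn).trans ((mul_le_mul_of_nonneg_right ih (Real.exp_nonneg _)).trans ?_)
      rw [Finset.sum_range_succ, mul_add, Real.exp_add, mul_assoc]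
  refine ⟨∑ i ∈ Finset.range n₀, a i + (1 + a n₀) * Real.exp (2 * ∑' i, ε i), fun n => ?_⟩
  have hs0 : 0 ≤ ∑ i ∈ Finset.range n₀, a i := Finset.sum_nonneg fun i _ => ha i
  have he0 : 0 ≤ (1 + a n₀) * Real.exp (2 * ∑' i, ε i) :=
    mul_nonneg (by linarith [ha n₀]) (Real.exp_nonneg _)
  rcases lt_or_ge n n₀ with hn | hn
  · have := Finset.single_le_sum (f := a) (fun i _ => ha i) (Finset.mem_range.2 hn)
    linarith
  · have h1 := hind n hn
    have h2 : (1 + a n₀) * Real.exp (2 * ∑ i ∈ Finset.range n, ε i) ≤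
        (1 + a n₀) * Real.exp (2 * ∑' i, ε i) := by
      refine mul_le_mul_of_nonneg_left (Real.exp_le_exp.2 ?_) (by linarith [ha n₀])
      exact mul_le_mul_of_nonneg_left (hsum.sum_le_tsum _ fun i _ => hε i) (by norm_num)
    linarith

/-- `belowGain` is bounded uniformly in the level, and its increments in the level and in space
decay like `n 2^{-n/2}`. -/
theorem exists_uniform_estimates {S : PricePath} {T : ℝ≥0} {R B : ℝ} (hR : ∀ t ≤ T, |S t| ≤ R)
    (hB : 0 < B) (hS : LocalGainBound S B) :
    ∃ C : ℝ, 0 ≤ C ∧ (∀ n, ∀ t ≤ T, ∀ u, |belowGain S n t u| ≤ C) ∧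
      (∀ n, ∀ t ≤ T, ∀ k : ℤ, |belowGain S n t ((k + 1 : ℤ) * ((2 : ℝ) ^ n)⁻¹) -
        belowGain S n t (k * ((2 : ℝ) ^ n)⁻¹)| ≤ C * (rootScale n * (n + 1))) ∧
      ∀ n, ∀ t ≤ T, ∀ u, |belowGain S (n + 1) t u - belowGain S n t u| ≤
        C * (rootScale n * (n + 1)) := by
  obtain ⟨C, hC0, hC⟩ := exists_level_estimates hR hB hS
  set a : ℕ → ℝ := fun n => sSup {x | ∃ t ≤ T, ∃ u, x = |belowGain S n t u|} with ha
  have hbdd : ∀ n, BddAbove {x | ∃ t ≤ T, ∃ u, x = |belowGain S n t u|} := by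
    intro n
    obtain ⟨m, hm⟩ := exists_belowGain_bound S T n
    exact ⟨m, by rintro _ ⟨t, ht, u, rfl⟩; exact hm t ht u⟩
  have hle : ∀ n, ∀ t ≤ T, ∀ u, |belowGain S n t u| ≤ a n := fun n t ht u =>
    le_csSup (hbdd n) ⟨t, ht, u, rfl⟩
  have ha0 : ∀ n, 0 ≤ a n := fun n => (abs_nonneg _).trans (hle n 0 bot_le 0)
  set ε : ℕ → ℝ := fun n => C * (rootScale (n + 1) * ((n + 1 : ℕ) + 1)) with hε
  have hε0 : ∀ n, 0 ≤ ε n := fun n =>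
    mul_nonneg hC0 (mul_nonneg (rootScale_pos _).le (by positivity))
  have hεs : Summable ε :=
    ((summable_nat_add_iff 1).2 summable_rootScale_mul).mul_left C
  have hrec : ∀ n, a (n + 1) ≤ a n + ε n * (1 + a (n + 1)) := by
    intro n
    refine csSup_le ⟨_, 0, bot_le, 0, rfl⟩ ?_
    rintro _ ⟨t, ht, u, rfl⟩
    have h1 := (hC (n + 1) (a (n + 1)) (hle (n + 1))).2 t ht u
    have h2 := abs_sub_abs_le_abs_sub (belowGain S (n + 1) t u) (belowGain S n t u)
    rw [Nat.add_sub_cancel] at h1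
    have h3 := hle n t ht u
    simp only [hε]
    linarith
  obtain ⟨M, hM⟩ := bddAbove_of_le_add_mul ha0 hε0 hεs hrec
  have hM0 : 0 ≤ M := (ha0 0).trans (hM 0)
  -- The estimates between levels `n` and `n + 1` come with the scale of `n + 1`; passing to that of
  -- `n` costs a factor `2`.
  have hmono : ∀ n, rootScale (n + 1) * ((n + 1 : ℕ) + 1) ≤ 2 * (rootScale n * (n + 1)) := by
    intro n
    have h1 : rootScale (n + 1) ≤ rootScale n := by
      rw [rootScale, rootScale]
      have h2 : (1 : ℝ) ≤ √2 := by rw [Real.one_le_sqrt]; norm_num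
      exact inv_anti₀ (by positivity) (pow_le_pow_right₀ h2 (Nat.le_succ n))
    have h3 : (0 : ℝ) ≤ n := Nat.cast_nonneg n
    calc rootScale (n + 1) * ((n + 1 : ℕ) + 1) ≤ rootScale n * (2 * (n + 1)) :=
          mul_le_mul h1 (by push_cast; linarith) (by positivity) (rootScale_pos n).le
      _ = _ := by ring
  refine ⟨M + 2 * (C * (1 + M)), by positivity, fun n t ht u => ?_, fun n t ht k => ?_,
    fun n t ht u => ?_⟩
  · have : 0 ≤ C * (1 + M) := by positivity
    linarith [hle n t ht u, hM n]
  · refine ((hC n M fun t ht u => (hle n t ht u).trans (hM n)).1 t ht k).trans ?_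
    have h1 : 0 ≤ rootScale n * (n + 1) := mul_nonneg (rootScale_pos _).le (by positivity)
    have h2 : 0 ≤ C * (1 + M) := by positivity
    nlinarith
  · have h3 := (hC (n + 1) M fun t ht u => (hle _ t ht u).trans (hM _)).2 t ht u
    rw [Nat.add_sub_cancel] at h3
    refine h3.trans ?_
    have h1 : 0 ≤ rootScale n * (n + 1) := mul_nonneg (rootScale_pos _).le (by positivity)
    have h2 : 0 ≤ C * (1 + M) := by positivity
    have h4 := mul_le_mul_of_nonneg_left (hmono n) h2
    nlinarith

/-! ### Convergence, Hölder regularity and `p`-variation -/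

/-- The limit of `belowGain` as the mesh of the dyadic grid tends to zero. -/
def belowLimit (S : PricePath) (t : ℝ≥0) (u : ℝ) : ℝ :=
  limUnder atTop fun n => belowGain S n t u

/-- With `r = 2^{β - 1/2} < 1` the claim is that `r ^ n * (n + 1)` is bounded. This is where the
logarithmic loss is traded for exponents strictly below `1/2`. -/
theorem exists_rootScale_mul_le {β : ℝ} (hβ : β < 1 / 2) :
    ∃ K : ℝ, 0 ≤ K ∧ ∀ n : ℕ, rootScale n * (n + 1) ≤ K * (2 : ℝ) ^ (-(n * β)) := by
  set r : ℝ := (√2)⁻¹ * 2 ^ β with hr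
  have hr0 : 0 < r := by positivity
  have hr1 : r < 1 := by
    rw [hr, Real.sqrt_eq_rpow, ← Real.rpow_neg (by norm_num), ← Real.rpow_add (by norm_num)]
    exact Real.rpow_lt_one_of_one_lt_of_neg (by norm_num) (by linarith)
  have hnorm : ‖r‖ < 1 := by rwa [Real.norm_of_nonneg hr0.le]
  have h1 := (summable_pow_mul_geometric_of_norm_lt_one 1 hnorm).add
    (summable_geometric_of_norm_lt_one hnorm)
  obtain ⟨K, hK⟩ := h1.tendsto_atTop_zero.bddAbove_range
  refine ⟨max K 0, le_max_right _ _, fun n => ?_⟩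
  have h2 : r ^ n * (n + 1) ≤ max K 0 := by
    refine le_trans (le_of_eq ?_) ((hK ⟨n, rfl⟩).trans (le_max_left _ _))
    simp only [pow_one]; ring
  have h3 : rootScale n = r ^ n * (2 : ℝ) ^ (-(n * β)) := by
    have h4 : ((2 : ℝ) ^ β) ^ n = (2 : ℝ) ^ (n * β) := by
      rw [← Real.rpow_natCast, ← Real.rpow_mul (by norm_num), mul_comm]
    rw [hr, mul_pow, h4, mul_assoc, ← Real.rpow_add (by norm_num), add_neg_cancel, Real.rpow_zero,
      mul_one, rootScale, inv_pow]
  rw [h3]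
  calc r ^ n * (2 : ℝ) ^ (-(n * β)) * (n + 1) = r ^ n * (n + 1) * (2 : ℝ) ^ (-(n * β)) := by ring
    _ ≤ _ := mul_le_mul_of_nonneg_right h2 (by positivity)

theorem rpow_neg_natCast_mul (β : ℝ) (n : ℕ) :
    (2 : ℝ) ^ (-(n * β)) = ((2 : ℝ) ^ (-β)) ^ n := by
  rw [← Real.rpow_natCast, ← Real.rpow_mul (by norm_num)]
  congr 1; ring

theorem inv_two_pow_le_rpow {β : ℝ} (hβ : β ≤ 1) (n : ℕ) :
    ((2 : ℝ) ^ n)⁻¹ ≤ (2 : ℝ) ^ (-(n * β)) := by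
  rw [← Real.rpow_natCast, ← Real.rpow_neg (by norm_num)]
  refine Real.rpow_le_rpow_of_exponent_le (by norm_num) ?_
  have : (0 : ℝ) ≤ n := Nat.cast_nonneg n
  nlinarith

/-- For all `β < 1/2`, `belowGain` converges at rate `2^{-nβ}`, uniformly on `[0,T] × ℝ`, and its
jumps are of the same order. -/
theorem exists_rate {S : PricePath} {T : ℝ≥0} {R B : ℝ} (hR : ∀ t ≤ T, |S t| ≤ R)
    (hB : 0 < B) (hS : LocalGainBound S B) {β : ℝ} (hβ₀ : 0 < β) (hβ : β < 1 / 2) :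
    ∃ C : ℝ, 0 ≤ C ∧ (∀ n, ∀ t ≤ T, ∀ u, |belowGain S n t u| ≤ C) ∧
      (∀ n, ∀ t ≤ T, ∀ k : ℤ, |belowGain S n t ((k + 1 : ℤ) * ((2 : ℝ) ^ n)⁻¹) -
        belowGain S n t (k * ((2 : ℝ) ^ n)⁻¹)| ≤ C * (2 : ℝ) ^ (-(n * β))) ∧
      ∀ n : ℕ, ∀ t ≤ T, ∀ u, |belowGain S n t u - belowLimit S t u| ≤
        C * (2 : ℝ) ^ (-(n * β)) := by
  obtain ⟨C, hC0, h1, h2, h3⟩ := exists_uniform_estimates hR hB hS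
  obtain ⟨K, hK0, hK⟩ := exists_rootScale_mul_le hβ
  set q : ℝ := (2 : ℝ) ^ (-β) with hq
  have hq0 : 0 < q := by positivity
  have hq1 : q < 1 := Real.rpow_lt_one_of_one_lt_of_neg (by norm_num) (by linarith)
  have hCK : 0 ≤ C * K := mul_nonneg hC0 hK0
  have hden : 0 < 1 - q := by linarith
  have hlim0 : 0 ≤ C * K / (1 - q) := div_nonneg hCK hden.le
  have hlim : ∀ n : ℕ, ∀ t ≤ T, ∀ u, |belowGain S n t u - belowLimit S t u| ≤
      C * K / (1 - q) * (2 : ℝ) ^ (-(n * β)) := by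
    intro n t ht u
    have hd : ∀ n : ℕ, dist (belowGain S n t u) (belowGain S (n + 1) t u) ≤ C * K * q ^ n := by
      intro n
      rw [dist_comm, Real.dist_eq, ← rpow_neg_natCast_mul, mul_assoc]
      exact (h3 n t ht u).trans (mul_le_mul_of_nonneg_left (hK n) hC0)
    have hc := cauchySeq_of_le_geometric q (C * K) hq1 hd
    have := dist_le_of_le_geometric_of_tendsto q (C * K) hq1 hd hc.tendsto_limUnder n
    rw [Real.dist_eq] at this
    rw [rpow_neg_natCast_mul]
    refine this.trans (le_of_eq ?_)
    ring
  refine ⟨C + C * K + C * K / (1 - q), by positivity, fun n t ht u => ?_, fun n t ht k => ?_,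
    fun n t ht u => ?_⟩
  · linarith [h1 n t ht u]
  · refine (h2 n t ht k).trans ((mul_le_mul_of_nonneg_left (hK n) hC0).trans ?_)
    rw [← mul_assoc]
    exact mul_le_mul_of_nonneg_right (by linarith) (by positivity)
  · exact (hlim n t ht u).trans (mul_le_mul_of_nonneg_right (by linarith) (by positivity))

/-- Points at distance at most `2⁻ⁿ` round up to equal or adjacent grid points, so at most one grid
increment and two rounding errors occur. -/
theorem abs_belowGain_sub_le_of_abs_sub_le {S : PricePath} {T : ℝ≥0} {C δ : ℝ} {n : ℕ}
    (hC : ∀ t ≤ T, ∀ k : ℤ, |belowGain S n t ((k + 1 : ℤ) * ((2 : ℝ) ^ n)⁻¹) -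
        belowGain S n t (k * ((2 : ℝ) ^ n)⁻¹)| ≤ C) (hC0 : 0 ≤ C) (hδ : ((2 : ℝ) ^ n)⁻¹ ≤ δ)
    {t : ℝ≥0} (ht : t ≤ T) {u v : ℝ} (huv : |u - v| ≤ ((2 : ℝ) ^ n)⁻¹) :
    |belowGain S n t u - belowGain S n t v| ≤ C + 2 * δ := by
  wlog hle : v ≤ u generalizing u v
  · rw [abs_sub_comm]
    exact this (by rwa [abs_sub_comm]) (le_of_not_ge hle)
  have hpos : (0 : ℝ) < 2 ^ n := by positivity
  have h1 := abs_belowGain_sub_ceil_le S (le_refl n) t u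
  have h2 := abs_belowGain_sub_ceil_le S (le_refl n) t v
  have hmono : ⌈v * 2 ^ n⌉ ≤ ⌈u * 2 ^ n⌉ := Int.ceil_mono (by gcongr)
  have hupper : ⌈u * 2 ^ n⌉ ≤ ⌈v * 2 ^ n⌉ + 1 := by
    rw [Int.ceil_le]
    push_cast
    have h3 : (u - v) * 2 ^ n ≤ 1 := by
      rw [← le_div_iff₀ hpos, one_div]; exact (le_abs_self _).trans huv
    linarith [Int.le_ceil (v * 2 ^ n)]
  have h3 : |belowGain S n t (⌈u * 2 ^ n⌉ * ((2 : ℝ) ^ n)⁻¹) -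
      belowGain S n t (⌈v * 2 ^ n⌉ * ((2 : ℝ) ^ n)⁻¹)| ≤ C := by
    rcases (by omega : ⌈u * 2 ^ n⌉ = ⌈v * 2 ^ n⌉ ∨ ⌈u * 2 ^ n⌉ = ⌈v * 2 ^ n⌉ + 1) with h | h
    · rw [h, sub_self, abs_zero]; exact hC0
    · rw [h]; exact hC t ht _
  rw [abs_le] at h1 h2 h3 ⊢
  constructor <;> linarith

/-- `belowLimit` is Hölder continuous of every order `β < 1/2`. -/
theorem exists_holder_belowLimit {S : PricePath} {T : ℝ≥0} {R B : ℝ} (hR : ∀ t ≤ T, |S t| ≤ R)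
    (hB : 0 < B) (hS : LocalGainBound S B) {β : ℝ} (hβ₀ : 0 < β) (hβ : β < 1 / 2) :
    ∃ C : ℝ, 0 ≤ C ∧ (∀ t ≤ T, ∀ u, |belowLimit S t u| ≤ C) ∧
      (∀ t ≤ T, ∀ u v, |belowLimit S t u - belowLimit S t v| ≤ C * |u - v| ^ β) ∧
      ∀ n : ℕ, ∀ t ≤ T, ∀ u, |belowGain S n t u - belowLimit S t u| ≤
        C * (2 : ℝ) ^ (-(n * β)) := by
  obtain ⟨C, hC0, h1, h2, h3⟩ := exists_rate hR hB hS hβ₀ hβ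
  have hbd : ∀ t ≤ T, ∀ u, |belowLimit S t u| ≤ 2 * C := by
    intro t ht u
    have h4 := h1 0 t ht u
    have h5 := h3 0 t ht u
    simp only [CharP.cast_eq_zero, zero_mul, neg_zero, Real.rpow_zero, mul_one] at h5
    rw [abs_le] at *
    constructor <;> linarith
  refine ⟨4 * C + 2 ^ β * (3 * C + 2), by positivity, fun t ht u => ?_, fun t ht u v => ?_,
    fun n t ht u => ?_⟩
  · have : 0 ≤ 2 ^ β * (3 * C + 2) := by positivity
    linarith [hbd t ht u]
  · have hp1 : 0 ≤ 2 ^ β * (3 * C + 2) := by positivity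
    rcases eq_or_ne u v with rfl | hne
    · rw [sub_self, abs_zero]; positivity
    have habs : 0 < |u - v| := abs_pos.2 (sub_ne_zero.2 hne)
    rcases le_or_gt 1 |u - v| with h | h
    · have h4 := hbd t ht u
      have h5 := hbd t ht v
      have h6 : 1 ≤ |u - v| ^ β := Real.one_le_rpow h hβ₀.le
      have h7 : |belowLimit S t u - belowLimit S t v| ≤ 4 * C := by
        rw [abs_le] at *; constructor <;> linarith
      nlinarith
    -- The level is chosen so that `2^{-(n+1)} < |u - v| ≤ 2⁻ⁿ`; the approximation error and the
    -- grid increment are then both of order `|u - v| ^ β`.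
    · obtain ⟨n, hn1, hn2⟩ := exists_nat_pow_near_of_lt_one habs h.le
        (by norm_num : (0 : ℝ) < 1 / 2) (by norm_num)
      rw [one_div, inv_pow] at hn1 hn2
      set x := (2 : ℝ) ^ (-(n * β)) with hx
      have hδ : ((2 : ℝ) ^ n)⁻¹ ≤ x := inv_two_pow_le_rpow (by linarith) n
      have h4 := abs_belowGain_sub_le_of_abs_sub_le (h2 n) (by positivity) hδ ht hn2
      have h5 := h3 n t ht u
      have h6 := h3 n t ht v
      have h7 : |belowLimit S t u - belowLimit S t v| ≤ (3 * C + 2) * x := by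
        rw [abs_le] at *; constructor <;> linarith
      have h8 : x ≤ 2 ^ β * |u - v| ^ β := by
        have h9 : (2 : ℝ) * ((2 : ℝ) ^ (n + 1))⁻¹ = ((2 : ℝ) ^ n)⁻¹ := by
          rw [pow_succ, mul_inv]; ring
        have h10 : x = (((2 : ℝ) ^ n)⁻¹) ^ β := by
          rw [hx, ← Real.rpow_natCast, ← Real.rpow_neg (by norm_num),
            ← Real.rpow_mul (by norm_num)]
          congr 1; ring
        rw [h10, ← Real.mul_rpow (by norm_num) habs.le]
        exact Real.rpow_le_rpow (by positivity) (by linarith) hβ₀.le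
      calc |belowLimit S t u - belowLimit S t v| ≤ (3 * C + 2) * x := h7
        _ ≤ (3 * C + 2) * (2 ^ β * |u - v| ^ β) :=
            mul_le_mul_of_nonneg_left h8 (by positivity)
        _ ≤ _ := by
            have : 0 ≤ 4 * C * |u - v| ^ β := by positivity
            linarith
  · refine (h3 n t ht u).trans (mul_le_mul_of_nonneg_right ?_ (by positivity))
    have : 0 ≤ 2 ^ β * (3 * C + 2) := by positivity
    linarith

/-- The limit of the discrete local times along the dyadic Lebesgue partitions. -/
def localTimeLimit (S : PricePath) (t : ℝ≥0) (u : ℝ) : ℝ :=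
  max (u - S t) 0 - max (u - S 0) 0 + belowLimit S t u

theorem discreteLocalTime_sub_localTimeLimit (S : PricePath) (n : ℕ) (t : ℝ≥0) (u : ℝ) :
    discreteLocalTime S (lebesguePartition S n) t u - localTimeLimit S t u =
      belowGain S n t u - belowLimit S t u := by
  rw [discreteLocalTime_eq, localTimeLimit]; ring

theorem abs_max_sub_max_le_abs_sub (u v a b : ℝ) :
    |max (u - a) 0 - max (v - b) 0| ≤ |u - v| + |a - b| := by
  refine (abs_max_sub_max_le_abs _ _ _).trans ?_
  rw [show u - a - (v - b) = (u - v) - (a - b) by ring]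
  exact abs_sub _ _

/-- The additional term is Lipschitz, which handles `|u - v| ≤ 1`, and bounded by `2 * R`, which
handles larger distances. -/
theorem exists_holder_localTimeLimit {S : PricePath} {T : ℝ≥0} {R B : ℝ}
    (hR : ∀ t ≤ T, |S t| ≤ R) (hB : 0 < B) (hS : LocalGainBound S B) {β : ℝ} (hβ₀ : 0 < β)
    (hβ : β < 1 / 2) :
    ∃ C : ℝ, 0 ≤ C ∧ (∀ t ≤ T, ∀ u, |localTimeLimit S t u| ≤ C) ∧
      ∀ t ≤ T, ∀ u v, |localTimeLimit S t u - localTimeLimit S t v| ≤ C * |u - v| ^ β := by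
  obtain ⟨C, hC0, h1, h2, -⟩ := exists_holder_belowLimit hR hB hS hβ₀ hβ
  have hR0 : 0 ≤ R := (abs_nonneg _).trans (hR 0 bot_le)
  have hg : ∀ t ≤ T, ∀ u, |max (u - S t) 0 - max (u - S 0) 0| ≤ 2 * R := by
    intro t ht u
    have h3 := abs_max_sub_max_le_abs_sub u u (S t) (S 0)
    have h4 := abs_sub (S t) (S 0)
    have h5 := hR t ht
    have h6 := hR 0 bot_le
    rw [sub_self, abs_zero] at h3
    linarith
  refine ⟨C + 4 * R + 2, by positivity, fun t ht u => ?_, fun t ht u v => ?_⟩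
  · refine (abs_add_le _ _).trans ?_
    linarith [hg t ht u, h1 t ht u]
  · have hpow : 0 ≤ |u - v| ^ β := by positivity
    have h3 : |(max (u - S t) 0 - max (u - S 0) 0) - (max (v - S t) 0 - max (v - S 0) 0)| ≤
        (4 * R + 2) * |u - v| ^ β := by
      rcases le_or_gt |u - v| 1 with h | h
      · have h4 : |u - v| ≤ |u - v| ^ β := by
          simpa using Real.rpow_le_rpow_of_exponent_ge' (abs_nonneg _) h hβ₀.le
            (by linarith : β ≤ 1)
        have h5 := abs_max_sub_max_le_abs_sub u v (S t) (S t)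
        have h6 := abs_max_sub_max_le_abs_sub u v (S 0) (S 0)
        rw [sub_self, abs_zero] at h5 h6
        have h7 : 0 ≤ R * |u - v| ^ β := by positivity
        rw [abs_le] at h5 h6 ⊢
        constructor <;> linarith
      · have h4 : 1 ≤ |u - v| ^ β := Real.one_le_rpow h.le hβ₀.le
        have h5 := hg t ht u
        have h6 := hg t ht v
        have h7 : (4 * R + 2) ≤ (4 * R + 2) * |u - v| ^ β :=
          le_mul_of_one_le_right (by positivity) h4
        rw [abs_le] at h5 h6 ⊢
        constructor <;> linarith
    have h8 := h2 t ht u v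
    simp only [localTimeLimit]
    rw [abs_le] at h3 h8 ⊢
    constructor <;> linarith

theorem continuous_valueAtMin (S : PricePath) (τ : WithTop ℝ≥0) :
    Continuous fun t : ℝ≥0 => valueAtMin S τ t := by
  by_cases h : τ = ⊤
  · have : (fun t : ℝ≥0 => valueAtMin S τ t) = fun t => S t := by
      ext t; exact valueAtMin_of_ge (by rw [h]; exact le_top)
    rw [this]; exact S.continuous
  · obtain ⟨r, rfl⟩ := WithTop.ne_top_iff_exists.1 h
    have : (fun t : ℝ≥0 => valueAtMin S r t) = fun t => S (min t r) := by
      ext t; rw [valueAtMin]; rfl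
    rw [this]; fun_prop

/-- Uniformity in `u` holds because only the positions depend on `u`, and they are bounded by `1`;
the continuous stopped values and the number of terms up to `T` do not. -/
theorem eventually_abs_belowGain_sub_le (S : PricePath) (T : ℝ≥0) (n : ℕ) {t : ℝ≥0}
    (ht : t ≤ T) {ε : ℝ} (hε : 0 < ε) :
    ∀ᶠ s in 𝓝 t, s ≤ T → ∀ u, |belowGain S n s u - belowGain S n t u| ≤ ε := by
  obtain ⟨J, -, h₂⟩ := exists_lebesguePartition_le_lt S n T
  set V : ℕ → ℝ≥0 → ℝ := fun k s => valueAtMin S (lebesguePartition S n k) s with hV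
  have hcont : Continuous fun s => ∑ k ∈ Finset.range (J + 1),
      (|V (k + 1) s - V (k + 1) t| + |V k s - V k t|) := by
    refine continuous_finsetSum _ fun k _ => ?_
    exact (((continuous_valueAtMin S _).sub continuous_const).abs).add
      (((continuous_valueAtMin S _).sub continuous_const).abs)
  have hev := (hcont.tendsto t).eventually (eventually_lt_nhds (by simpa using hε))
  filter_upwards [hev] with s hs hsT u
  refine le_trans ?_ hs.le
  have hform : ∀ r ≤ T, belowGain S n r u =
      ∑ k ∈ Finset.range (J + 1), belowIndicator S n u k * (V (k + 1) r - V k r) := fun r hr =>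
    tsum_partition_eq_sum ((WithTop.coe_le_coe.2 hr).trans h₂.le)
      (fun k x y => belowIndicator S n u k * (y - x)) (by simp)
  rw [hform s hsT, hform t ht, ← Finset.sum_sub_distrib]
  refine (Finset.abs_sum_le_sum_abs _ _).trans (Finset.sum_le_sum fun k _ => ?_)
  rw [← mul_sub, abs_mul]
  have hb : |belowIndicator S n u k| ≤ 1 := by rw [belowIndicator]; split_ifs <;> simp
  refine (mul_le_of_le_one_left (abs_nonneg _) hb).trans ?_
  rw [show V (k + 1) s - V k s - (V (k + 1) t - V k t) =
    (V (k + 1) s - V (k + 1) t) - (V k s - V k t) by ring]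
  exact abs_sub _ _

/-- Continuity in time passes to the limit by uniform convergence; for this any rate exponent in
`(0, 1/2)` would do. -/
theorem eventually_abs_localTimeLimit_sub_le {S : PricePath} {T : ℝ≥0} {R B : ℝ}
    (hR : ∀ t ≤ T, |S t| ≤ R) (hB : 0 < B) (hS : LocalGainBound S B) {t : ℝ≥0} (ht : t ≤ T)
    {ε : ℝ} (hε : 0 < ε) :
    ∀ᶠ s in 𝓝 t, s ≤ T → ∀ u, |localTimeLimit S s u - localTimeLimit S t u| ≤ ε := by
  obtain ⟨C, hC0, -, -, h3⟩ := exists_rate hR hB hS (β := 1 / 4) (by norm_num) (by norm_num)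
  have hlim : Tendsto (fun n : ℕ => C * (2 : ℝ) ^ (-(n * (1 / 4 : ℝ)))) atTop (𝓝 0) := by
    simp only [rpow_neg_natCast_mul]
    simpa using (tendsto_pow_atTop_nhds_zero_of_lt_one (by positivity)
      (Real.rpow_lt_one_of_one_lt_of_neg (by norm_num) (by norm_num) :
        (2 : ℝ) ^ (-(1 / 4 : ℝ)) < 1)).const_mul C
  obtain ⟨n, hn⟩ := (hlim.eventually (gt_mem_nhds (by positivity : 0 < ε / 4))).exists
  have hScont : ∀ᶠ s in 𝓝 t, |S s - S t| < ε / 4 := by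
    have := (S.continuous.tendsto t).eventually (Metric.ball_mem_nhds (S t)
      (by positivity : 0 < ε / 4))
    simpa [Real.dist_eq] using this
  filter_upwards [hScont, eventually_abs_belowGain_sub_le S T n ht (by positivity : 0 < ε / 4)]
    with s hs1 hs2 hsT u
  have h4 := hs2 hsT u
  have h5 := h3 n s hsT u
  have h6 := h3 n t ht u
  have h7 := abs_max_sub_max_le_abs_sub u u (S s) (S t)
  rw [sub_self, abs_zero] at h7
  simp only [localTimeLimit]
  rw [abs_le] at h4 h5 h6 h7 ⊢
  constructor <;> linarith

theorem holderWith_of_abs_sub_le {C α : ℝ≥0} {f : ℝ → ℝ}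
    (h : ∀ u v, |f u - f v| ≤ C * |u - v| ^ (α : ℝ)) : HolderWith C α f := by
  intro u v
  rw [edist_dist, edist_dist, Real.dist_eq, Real.dist_eq,
    ENNReal.ofReal_rpow_of_nonneg (abs_nonneg _) α.coe_nonneg, ← ENNReal.ofReal_coe_nnreal,
    ← ENNReal.ofReal_mul C.coe_nonneg]
  exact ENNReal.ofReal_le_ofReal (h u v)

theorem holderSpaceNorm_le {C D α : ℝ≥0} {f : ℝ → ℝ} (hf : ∀ u, |f u| ≤ D)
    (h : ∀ u v, |f u - f v| ≤ C * |u - v| ^ (α : ℝ)) :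
    holderSpaceNorm α f ≤ D + C := by
  refine add_le_add (iSup_le fun u => ?_) (holderWith_of_abs_sub_le h).eHolderNorm_le
  rw [Real.enorm_eq_ofReal_abs, ← ENNReal.ofReal_coe_nnreal]
  exact ENNReal.ofReal_le_ofReal (hf u)

/-- A small function that is bounded in a Hölder norm is small in weaker Hölder norms. -/
theorem exists_abs_sub_le_of_holder {C α β η : ℝ} (hα : 0 ≤ α) (hαβ : α < β) (hC : 0 ≤ C)
    (hη : 0 < η) : ∃ δ > 0, ∀ f : ℝ → ℝ, (∀ u, |f u| ≤ δ) →
      (∀ u v, |f u - f v| ≤ C * |u - v| ^ β) → ∀ u v, |f u - f v| ≤ η * |u - v| ^ α := by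
  have hlim : Tendsto (fun r : ℝ => C * r ^ (β - α)) (𝓝[>] 0) (𝓝 0) := by
    have h1 : ContinuousAt (fun r : ℝ => C * r ^ (β - α)) 0 :=
      continuousAt_const.mul (Real.continuousAt_rpow_const 0 (β - α) (Or.inr (by linarith)))
    have h2 := h1.tendsto.mono_left (nhdsWithin_le_nhds (s := Set.Ioi 0))
    simpa [Real.zero_rpow (by linarith : β - α ≠ 0)] using h2
  obtain ⟨r, hr, hr0⟩ := ((hlim.eventually (gt_mem_nhds hη)).and self_mem_nhdsWithin).exists
  have hr0 : 0 < r := hr0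
  -- Below distance `r` the surplus exponent gives the factor `C * r ^ (β - α) ≤ η`; above `r` the
  -- supremum bound is enough.
  refine ⟨η * r ^ α / 2, by positivity, fun f hf hfβ u v => ?_⟩
  rcases le_or_gt |u - v| r with h | h
  · refine (hfβ u v).trans ?_
    rcases eq_or_lt_of_le (abs_nonneg (u - v)) with h0 | h0
    · rw [← h0, Real.zero_rpow (by linarith), mul_zero]
      positivity
    · have h1 : |u - v| ^ β = |u - v| ^ (β - α) * |u - v| ^ α := by
        rw [← Real.rpow_add h0, sub_add_cancel]
      rw [h1, ← mul_assoc]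
      refine mul_le_mul_of_nonneg_right (le_trans ?_ hr.le) (by positivity)
      exact mul_le_mul_of_nonneg_left
        (Real.rpow_le_rpow h0.le h (by linarith)) hC
  · have h1 := hf u
    have h2 := hf v
    have h3 : |f u - f v| ≤ η * r ^ α := by
      rw [abs_le] at h1 h2 ⊢; constructor <;> linarith
    exact h3.trans (mul_le_mul_of_nonneg_left (Real.rpow_le_rpow hr0.le h.le hα) hη.le)

/-- Interpolation: the limit is bounded in a stronger Hölder norm, with exponent strictly between
`α` and `1/2`, and is continuous in time for the supremum norm. -/
theorem isContinuousIntoHolder_localTimeLimit {S : PricePath} {T : ℝ≥0} {R B : ℝ}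
    (hR : ∀ t ≤ T, |S t| ≤ R) (hB : 0 < B) (hS : LocalGainBound S B) {α : ℝ≥0} (hα₀ : 0 < α)
    (hα : (α : ℝ) < 1 / 2) : IsContinuousIntoHolder T α (localTimeLimit S) := by
  constructor
  · intro t ht
    obtain ⟨C, hC0, h1, h2⟩ := exists_holder_localTimeLimit hR hB hS (NNReal.coe_pos.2 hα₀) hα
    lift C to ℝ≥0 using hC0
    exact (holderSpaceNorm_le (h1 t ht.2) (h2 t ht.2)).trans_lt
      (ENNReal.add_lt_top.2 ⟨ENNReal.coe_lt_top, ENNReal.coe_lt_top⟩)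
  · intro t ht
    obtain ⟨β, hαβ, hβ⟩ := exists_between hα
    have hβ₀ : 0 < β := (NNReal.coe_nonneg α).trans_lt hαβ
    obtain ⟨C, hC0, h1, h2⟩ := exists_holder_localTimeLimit hR hB hS hβ₀ hβ
    rw [ENNReal.tendsto_nhds_zero]
    intro ε hε
    obtain ⟨η', hη'0, hη'⟩ := ENNReal.lt_iff_exists_nnreal_btwn.1 hε
    have hη'0 : 0 < η' := ENNReal.coe_pos.1 hη'0
    set η : ℝ≥0 := η' / 2 with hη
    have hη0 : 0 < η := half_pos hη'0
    obtain ⟨δ, hδ0, hδ⟩ := exists_abs_sub_le_of_holder (C := 2 * C) (NNReal.coe_nonneg α) hαβ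
      (by positivity) (NNReal.coe_pos.2 hη0)
    have hev := eventually_abs_localTimeLimit_sub_le hR hB hS ht.2
      (lt_min hδ0 (NNReal.coe_pos.2 hη0))
    filter_upwards [nhdsWithin_le_nhds hev, self_mem_nhdsWithin] with s hs hsT
    have hs' := hs hsT.2
    refine (holderSpaceNorm_le (D := η) (C := η) (fun u => (hs' u).trans (min_le_right _ _))
      (hδ _ (fun u => (hs' u).trans (min_le_left _ _)) fun u v => ?_)).trans ?_
    · have h3 := h2 s hsT.2 u v
      have h4 := h2 t ht.2 u v
      rw [abs_le] at h3 h4 ⊢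
      constructor <;> linarith
    · rw [← ENNReal.coe_add, hη, add_halves]
      exact hη'.le

/-! ### Variation -/

theorem sum_fin_succ_sub_castSucc (N : ℕ) (g : Fin (N + 1) → ℝ) :
    ∑ k : Fin N, (g k.succ - g k.castSucc) = g (Fin.last N) - g 0 := by
  rw [Finset.sum_sub_distrib]
  linarith [Fin.sum_univ_succ g, Fin.sum_univ_castSucc g]

/-- The `p`-variation is bounded if the `p`-th powers of the increments are controlled by those of
a function with bounded range. -/
theorem pVariation_le {p D : ℝ} (hp : 0 < p) {f G : ℝ → ℝ}
    (hG : ∀ v u, v < u → |f u - f v| ^ p ≤ G u - G v) (hD : ∀ v u, v ≤ u → G u - G v ≤ D) :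
    pVariation p f ≤ ENNReal.ofReal D ^ (1 / p) := by
  refine iSup_le fun N => iSup₂_le fun u hu => ?_
  refine ENNReal.rpow_le_rpow ?_ (by positivity)
  calc ∑ k : Fin N, ‖f (u k.succ) - f (u k.castSucc)‖ₑ ^ p
      = ∑ k : Fin N, ENNReal.ofReal (|f (u k.succ) - f (u k.castSucc)| ^ p) := by
        refine Finset.sum_congr rfl fun k _ => ?_
        rw [Real.enorm_eq_ofReal_abs, ENNReal.ofReal_rpow_of_nonneg (abs_nonneg _) hp.le]
    _ = ENNReal.ofReal (∑ k : Fin N, |f (u k.succ) - f (u k.castSucc)| ^ p) :=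
        (ENNReal.ofReal_sum_of_nonneg fun k _ => by positivity).symm
    _ ≤ ENNReal.ofReal (∑ k : Fin N, (G (u k.succ) - G (u k.castSucc))) := by
        refine ENNReal.ofReal_le_ofReal (Finset.sum_le_sum fun k _ => hG _ _ (hu ?_))
        exact Fin.castSucc_lt_succ
    _ ≤ ENNReal.ofReal D := by
        rw [sum_fin_succ_sub_castSucc N fun k => G (u k)]
        exact ENNReal.ofReal_le_ofReal (hD _ _ (hu.monotone (Fin.zero_le _)))

theorem add_add_rpow_le {a b c p : ℝ} (ha : 0 ≤ a) (hb : 0 ≤ b) (hc : 0 ≤ c) (hp : 0 ≤ p) :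
    (a + b + c) ^ p ≤ 3 ^ p * (a ^ p + b ^ p + c ^ p) := by
  set m := max a (max b c) with hm
  have ham : a ≤ m := le_max_left _ _
  have hbm : b ≤ m := (le_max_left _ _).trans (le_max_right _ _)
  have hcm : c ≤ m := (le_max_right _ _).trans (le_max_right _ _)
  have h1 : (a + b + c) ^ p ≤ (3 * m) ^ p :=
    Real.rpow_le_rpow (by positivity) (by linarith) hp
  have h2 : m ^ p ≤ a ^ p + b ^ p + c ^ p := by
    have := Real.rpow_nonneg ha p
    have := Real.rpow_nonneg hb p
    have := Real.rpow_nonneg hc p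
    rcases max_choice a (max b c) with h | h
    · rw [hm, h]; linarith
    · rcases max_choice b c with h' | h' <;> rw [hm, h, h'] <;> linarith
  rw [Real.mul_rpow (by norm_num) (ha.trans ham)] at h1
  exact h1.trans (mul_le_mul_of_nonneg_left h2 (by positivity))

theorem rpow_le_mul_of_le {x a p : ℝ} (hx : 0 ≤ x) (hxa : x ≤ a) (hp : 1 ≤ p) :
    x ^ p ≤ a ^ (p - 1) * x := by
  rcases eq_or_lt_of_le hx with rfl | hx0
  · rw [Real.zero_rpow (by linarith), mul_zero]
  · have : x ^ p = x ^ (p - 1) * x := by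
      rw [← Real.rpow_add_one hx0.ne', sub_add_cancel]
    rw [this]
    exact mul_le_mul_of_nonneg_right (Real.rpow_le_rpow hx hxa (by linarith)) hx

/-- The projection of the real line to `[-r, r]`. -/
def clampTo (r u : ℝ) : ℝ := max (-r) (min u r)

theorem clampTo_mono (r : ℝ) : Monotone (clampTo r) := fun _ _ h =>
  max_le_max le_rfl (min_le_min h le_rfl)

theorem clampTo_mem {r : ℝ} (hr : 0 ≤ r) (u : ℝ) : -r ≤ clampTo r u ∧ clampTo r u ≤ r :=
  ⟨le_max_left _ _, max_le (by linarith) (min_le_right _ _)⟩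

theorem clampTo_cases {r : ℝ} (hr : 0 ≤ r) (u : ℝ) :
    (r ≤ u ∧ clampTo r u = r) ∨ (u ≤ -r ∧ clampTo r u = -r) ∨ clampTo r u = u := by
  rcases le_total r u with h | h
  · left; exact ⟨h, by rw [clampTo, min_eq_right h, max_eq_right (by linarith)]⟩
  · rcases le_total u (-r) with h' | h'
    · right; left; exact ⟨h', by rw [clampTo, min_eq_left h, max_eq_left h']⟩
    · right; right; rw [clampTo, min_eq_left h, max_eq_right h']

/-- The local time vanishes beyond the range of the path. Replacing `u` by its projection lets
unbounded control functions have bounded range on the whole line. -/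
theorem discreteLocalTime_clampTo {S : PricePath} {T : ℝ≥0} {R : ℝ} (hR : ∀ t ≤ T, |S t| ≤ R)
    (n : ℕ) {t : ℝ≥0} (ht : t ≤ T) (u : ℝ) :
    discreteLocalTime S (lebesguePartition S n) t (clampTo (R + 1) u) =
      discreteLocalTime S (lebesguePartition S n) t u := by
  have hR0 : 0 ≤ R := (abs_nonneg _).trans (hR 0 bot_le)
  have h1 := abs_le.1 (hR t ht)
  have h2 := abs_le.1 (hR 0 bot_le)
  rw [discreteLocalTime_eq, discreteLocalTime_eq]
  rcases clampTo_cases (by linarith : 0 ≤ R + 1) u with ⟨h, h'⟩ | ⟨h, h'⟩ | h'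
  · rw [h', belowGain_of_lt hR n ht (by linarith), belowGain_of_lt hR n ht (by linarith),
      max_eq_left (by linarith), max_eq_left (by linarith), max_eq_left (by linarith),
      max_eq_left (by linarith)]
    ring
  · rw [h', belowGain_of_le hR n ht (by linarith), belowGain_of_le hR n ht (by linarith),
      max_eq_right (by linarith), max_eq_right (by linarith), max_eq_right (by linarith),
      max_eq_right (by linarith)]
  · rw [h']

theorem belowIndicator_mono (S : PricePath) (n l : ℕ) :
    Monotone fun u => belowIndicator S n u l := by
  intro v u h
  simp only [belowIndicator]
  split_ifs <;> first | (exfalso; linarith) | norm_num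

/-- At a fixed level `belowGain` is a step function of `u`, so no Hölder bound in `y - x` can hold
uniformly in the level. The distance rounded to the grid replaces it: when nonzero it is at least
`2⁻ⁿ`, hence absorbs the approximation error, and it is additive over consecutive intervals. The
indicator accounts for a possible jump at `S 0`. -/
theorem abs_belowGain_sub_le_control {S : PricePath} {T : ℝ≥0} {C β : ℝ} (hβ₀ : 0 < β)
    (hβ : β ≤ 1) (hC0 : 0 ≤ C)
    (hC : ∀ t ≤ T, ∀ u v, |belowLimit S t u - belowLimit S t v| ≤ C * |u - v| ^ β)
    (hlim : ∀ n : ℕ, ∀ t ≤ T, ∀ u, |belowGain S n t u - belowLimit S t u| ≤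
        C * (2 : ℝ) ^ (-(n * β)))
    (n : ℕ) {t : ℝ≥0} (ht : t ≤ T) {x y : ℝ} (hxy : x ≤ y) :
    |belowGain S n t y - belowGain S n t x| ≤
      (belowIndicator S n y 0 - belowIndicator S n x 0) +
      4 * C * (((⌈y * 2 ^ n⌉ : ℝ) - ⌈x * 2 ^ n⌉) * ((2 : ℝ) ^ n)⁻¹) ^ β := by
  have hpos : (0 : ℝ) < 2 ^ n := by positivity
  have hb : 0 ≤ belowIndicator S n y 0 - belowIndicator S n x 0 :=
    sub_nonneg.2 (belowIndicator_mono S n 0 hxy)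
  have hmono : ⌈x * 2 ^ n⌉ ≤ ⌈y * 2 ^ n⌉ := Int.ceil_mono (by gcongr)
  rcases eq_or_lt_of_le hmono with h | h
  · rw [h, sub_self, zero_mul, Real.zero_rpow hβ₀.ne', mul_zero, add_zero]
    refine (abs_belowGain_sub_le_of_ceil_eq le_rfl h.symm).trans ?_
    rw [abs_of_nonneg hb]
    exact mul_le_of_le_one_right hb (inv_le_one_of_one_le₀ (one_le_pow₀ (by norm_num)))
  · set w := ((⌈y * 2 ^ n⌉ : ℝ) - ⌈x * 2 ^ n⌉) * ((2 : ℝ) ^ n)⁻¹ with hw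
    have hone : (1 : ℝ) ≤ (⌈y * 2 ^ n⌉ : ℝ) - ⌈x * 2 ^ n⌉ := by
      have : (⌈x * 2 ^ n⌉ : ℝ) + 1 ≤ ⌈y * 2 ^ n⌉ := by exact_mod_cast h
      linarith
    have hw1 : ((2 : ℝ) ^ n)⁻¹ ≤ w := le_mul_of_one_le_left (by positivity) hone
    have hw0 : 0 < w := lt_of_lt_of_le (by positivity) hw1
    have hyx : y - x ≤ 2 * w := by
      have h1 := Int.le_ceil (y * 2 ^ n)
      have h2 := Int.ceil_lt_add_one (x * 2 ^ n)
      have h3 : (y - x) * 2 ^ n ≤ 2 * ((⌈y * 2 ^ n⌉ : ℝ) - ⌈x * 2 ^ n⌉) := by linarith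
      rw [hw, ← mul_assoc, ← div_eq_mul_inv, le_div_iff₀ hpos]
      exact h3
    have h4 : (2 : ℝ) ^ (-(n * β)) ≤ w ^ β := by
      have h10 : (2 : ℝ) ^ (-(n * β)) = (((2 : ℝ) ^ n)⁻¹) ^ β := by
        rw [← Real.rpow_natCast, ← Real.rpow_neg (by norm_num), ← Real.rpow_mul (by norm_num)]
        congr 1; ring
      rw [h10]
      exact Real.rpow_le_rpow (by positivity) hw1 hβ₀.le
    have h5 : |y - x| ^ β ≤ 2 * w ^ β := by
      rw [abs_of_nonneg (by linarith)]
      refine (Real.rpow_le_rpow (by linarith) hyx hβ₀.le).trans ?_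
      rw [Real.mul_rpow (by norm_num) hw0.le]
      refine mul_le_mul_of_nonneg_right ?_ (by positivity)
      simpa using Real.rpow_le_rpow_of_exponent_le (by norm_num : (1 : ℝ) ≤ 2) hβ
    have h6 := (hlim n t ht y).trans (mul_le_mul_of_nonneg_left h4 hC0)
    have h7 := (hlim n t ht x).trans (mul_le_mul_of_nonneg_left h4 hC0)
    have h8 := (hC t ht y x).trans (mul_le_mul_of_nonneg_left h5 hC0)
    rw [abs_le] at h6 h7 h8 ⊢
    constructor <;> linarith

/-- The condition `p > 2` is `1/p < 1/2`, so the Hölder estimates apply with exponent `1/p`. Raised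
to the power `p`, the rounded distance enters linearly and its contributions telescope. -/
theorem exists_pVariation_le {S : PricePath} {T : ℝ≥0} {R B : ℝ} (hR : ∀ t ≤ T, |S t| ≤ R)
    (hB : 0 < B) (hS : LocalGainBound S B) {p : ℝ} (hp : 2 < p) :
    ∃ D : ℝ, ∀ n : ℕ, ∀ t ≤ T,
      pVariation p (discreteLocalTime S (lebesguePartition S n) t) ≤
        ENNReal.ofReal D ^ (1 / p) := by
  have hp0 : 0 < p := by linarith
  have hβ₀ : 0 < 1 / p := by positivity
  have hβ : 1 / p < 1 / 2 := one_div_lt_one_div_of_lt (by norm_num) hp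
  have hR0 : 0 ≤ R := (abs_nonneg _).trans (hR 0 bot_le)
  obtain ⟨C, hC0, -, hC, hlim⟩ := exists_holder_belowLimit hR hB hS hβ₀ hβ
  set A : ℝ := 2 ^ p * (2 * R + 2) ^ (p - 1) with hA
  have hA0 : 0 ≤ A := by positivity
  set K : ℝ := (4 * C) ^ p with hK
  have hK0 : 0 ≤ K := by positivity
  refine ⟨3 ^ p * (A * (2 * R + 2) + 1 + K * (2 * R + 3)), fun n t ht => ?_⟩
  have hpos : (0 : ℝ) < 2 ^ n := by positivity
  have hinv : ((2 : ℝ) ^ n)⁻¹ ≤ 1 := inv_le_one_of_one_le₀ (one_le_pow₀ (by norm_num))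
  -- The three terms control the Lipschitz part, the jump at `S 0` and the rounded distance; over
  -- `[-(R+1), R+1]` they vary by at most `A * (2 * R + 2)`, `1` and `K * (2 * R + 3)`.
  refine pVariation_le hp0 (G := fun u => 3 ^ p * (A * clampTo (R + 1) u +
    belowIndicator S n (clampTo (R + 1) u) 0 +
    K * (⌈clampTo (R + 1) u * 2 ^ n⌉ * ((2 : ℝ) ^ n)⁻¹))) (fun v u hvu => ?_) fun v u hvu => ?_
  · rw [← discreteLocalTime_clampTo hR n ht u, ← discreteLocalTime_clampTo hR n ht v]
    set x := clampTo (R + 1) v with hx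
    set y := clampTo (R + 1) u with hy
    have hxy : x ≤ y := clampTo_mono _ hvu.le
    have hx1 := clampTo_mem (by linarith : 0 ≤ R + 1) v
    have hy1 := clampTo_mem (by linarith : 0 ≤ R + 1) u
    rw [← hx] at hx1
    rw [← hy] at hy1
    set w := ((⌈y * 2 ^ n⌉ : ℝ) - ⌈x * 2 ^ n⌉) * ((2 : ℝ) ^ n)⁻¹ with hw
    have hmono : (⌈x * 2 ^ n⌉ : ℝ) ≤ ⌈y * 2 ^ n⌉ := by
      exact_mod_cast Int.ceil_mono (by gcongr)
    have hw0 : 0 ≤ w := mul_nonneg (sub_nonneg.2 hmono) (by positivity)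
    have hb0 : 0 ≤ belowIndicator S n y 0 - belowIndicator S n x 0 :=
      sub_nonneg.2 (belowIndicator_mono S n 0 hxy)
    have hb1 : belowIndicator S n y 0 - belowIndicator S n x 0 ≤ 1 :=
      (le_abs_self _).trans (abs_belowIndicator_sub_le S n 0 y x)
    have h1 : |discreteLocalTime S (lebesguePartition S n) t y -
        discreteLocalTime S (lebesguePartition S n) t x| ≤ 2 * (y - x) +
        (belowIndicator S n y 0 - belowIndicator S n x 0) + 4 * C * w ^ (1 / p) := by
      have h2 := abs_belowGain_sub_le_control hβ₀ (by linarith) hC0 hC hlim n ht hxy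
      have h3 := abs_max_sub_max_le_abs_sub y x (S t) (S t)
      have h4 := abs_max_sub_max_le_abs_sub y x (S 0) (S 0)
      rw [sub_self, abs_zero, add_zero, abs_of_nonneg (sub_nonneg.2 hxy)] at h3 h4
      rw [discreteLocalTime_eq, discreteLocalTime_eq]
      rw [abs_le] at h2 h3 h4 ⊢
      constructor <;> linarith
    have hyx0 : 0 ≤ y - x := sub_nonneg.2 hxy
    refine (Real.rpow_le_rpow (abs_nonneg _) h1 hp0.le).trans
      ((add_add_rpow_le (by positivity) hb0 (by positivity) hp0.le).trans ?_)
    rw [← mul_sub]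
    refine mul_le_mul_of_nonneg_left ?_ (by positivity)
    have h5 : (2 * (y - x)) ^ p ≤ A * (y - x) := by
      rw [Real.mul_rpow (by norm_num) hyx0, hA, mul_assoc]
      exact mul_le_mul_of_nonneg_left
        (rpow_le_mul_of_le hyx0 (by linarith) (by linarith)) (by positivity)
    have h6 : (belowIndicator S n y 0 - belowIndicator S n x 0) ^ p ≤
        belowIndicator S n y 0 - belowIndicator S n x 0 := by
      simpa using rpow_le_mul_of_le hb0 hb1 (by linarith : 1 ≤ p)
    have h7 : (4 * C * w ^ (1 / p)) ^ p = K * w := by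
      rw [Real.mul_rpow (by positivity) (by positivity), ← Real.rpow_mul hw0,
        one_div_mul_cancel hp0.ne', Real.rpow_one]
    rw [h7]
    calc _ ≤ A * (y - x) + (belowIndicator S n y 0 - belowIndicator S n x 0) + K * w := by
          linarith
      _ = _ := by rw [hw]; ring
  · set x := clampTo (R + 1) v with hx
    set y := clampTo (R + 1) u with hy
    have hxy : x ≤ y := clampTo_mono _ hvu
    have hx1 := clampTo_mem (by linarith : 0 ≤ R + 1) v
    have hy1 := clampTo_mem (by linarith : 0 ≤ R + 1) u
    rw [← hx] at hx1
    rw [← hy] at hy1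
    simp only [← mul_sub]
    refine mul_le_mul_of_nonneg_left ?_ (by positivity)
    have hb1 : belowIndicator S n y 0 - belowIndicator S n x 0 ≤ 1 :=
      (le_abs_self _).trans (abs_belowIndicator_sub_le S n 0 y x)
    have h1 : A * (y - x) ≤ A * (2 * R + 2) :=
      mul_le_mul_of_nonneg_left (by linarith) hA0
    have h2 : (⌈y * 2 ^ n⌉ : ℝ) * ((2 : ℝ) ^ n)⁻¹ - ⌈x * 2 ^ n⌉ * ((2 : ℝ) ^ n)⁻¹ ≤
        2 * R + 3 := by
      have h3 := Int.ceil_lt_add_one (y * 2 ^ n)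
      have h4 := Int.le_ceil (x * 2 ^ n)
      have h5 : (⌈y * 2 ^ n⌉ : ℝ) * ((2 : ℝ) ^ n)⁻¹ ≤ y + ((2 : ℝ) ^ n)⁻¹ := by
        rw [← div_eq_mul_inv, div_le_iff₀ hpos, add_mul, inv_mul_cancel₀ hpos.ne']
        exact h3.le
      have h6 : x ≤ (⌈x * 2 ^ n⌉ : ℝ) * ((2 : ℝ) ^ n)⁻¹ := by
        rw [← div_eq_mul_inv, le_div_iff₀ hpos]; exact h4
      linarith
    have h3 := mul_le_mul_of_nonneg_left h2 hK0
    linarith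

theorem exists_abs_le (S : PricePath) (T : ℝ≥0) : ∃ R, ∀ t ≤ T, |S t| ≤ R := by
  obtain ⟨R, hR⟩ := (isCompact_Icc (a := (0 : ℝ≥0)) (b := T)).exists_bound_of_continuousOn
    S.continuous.continuousOn
  exact ⟨R, fun t ht => hR t ⟨bot_le, ht⟩⟩

end

end VovkLocalTime

/-- Both claims hold off the same exceptional set, which depends on none of `T`, `α` and `p`. -/
theorem theorem3p2 (T : ℝ≥0) (hT : 0 < T) (α : ℝ≥0) (hα₀ : 0 < α) (hα : α < 1 / 2) :
    VovkLocalTime.ForTypicalPaths (fun S : VovkLocalTime.PricePath =>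
      ∃ L : ℝ≥0 → ℝ → ℝ,
        TendstoUniformlyOn
          (fun (n : ℕ) (z : ℝ≥0 × ℝ) => VovkLocalTime.discreteLocalTime S
            (VovkLocalTime.lebesguePartition S n) z.1 z.2)
          (fun z : ℝ≥0 × ℝ => L z.1 z.2) atTop (Set.Icc 0 T ×ˢ Set.univ) ∧
        VovkLocalTime.IsContinuousIntoHolder T α L ∧
        ∃ C : ℝ, 0 < C ∧
          (⨆ n : ℕ, ENNReal.ofReal ((2 : ℝ) ^ ((n : ℝ) * (α : ℝ))) *
            VovkLocalTime.supNorm T (fun t u => VovkLocalTime.discreteLocalTime S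
              (VovkLocalTime.lebesguePartition S n) t u - L t u)) ≤ ENNReal.ofReal C) ∧
    ∀ p : ℝ, 2 < p →
      VovkLocalTime.ForTypicalPaths (fun S : VovkLocalTime.PricePath =>
        (⨆ n : ℕ, ⨆ t ∈ Set.Icc 0 T,
          VovkLocalTime.pVariation p (VovkLocalTime.discreteLocalTime S
            (VovkLocalTime.lebesguePartition S n) t)) < ∞) := by
  have hα' : (α : ℝ) < 1 / 2 := by exact_mod_cast hα
  have hα₀' : (0 : ℝ) < α := NNReal.coe_pos.2 hα₀
  constructor
  · refine VovkLocalTime.forTypicalPaths_localGain_le.mono fun S hS => ?_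
    obtain ⟨B, hB, hS⟩ := hS
    obtain ⟨R, hR⟩ := VovkLocalTime.exists_abs_le S T
    obtain ⟨C, hC0, -, -, hlim⟩ := VovkLocalTime.exists_rate hR hB hS hα₀' hα'
    -- The rate constant `C` may be zero, so `C + 1` supplies the positive constant.
    refine ⟨VovkLocalTime.localTimeLimit S, ?_,
      VovkLocalTime.isContinuousIntoHolder_localTimeLimit hR hB hS hα₀ hα', C + 1,
      by positivity, iSup_le fun n => ?_⟩
    · have hzero : Tendsto (fun n : ℕ => C * (2 : ℝ) ^ (-(n * (α : ℝ)))) atTop (𝓝 0) := by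
        simp only [VovkLocalTime.rpow_neg_natCast_mul]
        simpa using (tendsto_pow_atTop_nhds_zero_of_lt_one (by positivity)
          (Real.rpow_lt_one_of_one_lt_of_neg (by norm_num) (by linarith) :
            (2 : ℝ) ^ (-(α : ℝ)) < 1)).const_mul C
      rw [Metric.tendstoUniformlyOn_iff]
      intro ε hε
      filter_upwards [hzero.eventually (gt_mem_nhds hε)] with n hn z hz
      rw [dist_comm, Real.dist_eq, VovkLocalTime.discreteLocalTime_sub_localTimeLimit]
      exact (hlim n z.1 hz.1.2 z.2).trans_lt hn
    · have hsup : VovkLocalTime.supNorm T (fun t u => VovkLocalTime.discreteLocalTime S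
          (VovkLocalTime.lebesguePartition S n) t u - VovkLocalTime.localTimeLimit S t u) ≤
          ENNReal.ofReal (C * (2 : ℝ) ^ (-(n * (α : ℝ)))) := by
        refine iSup₂_le fun t ht => iSup_le fun u => ?_
        beta_reduce
        rw [Real.enorm_eq_ofReal_abs, VovkLocalTime.discreteLocalTime_sub_localTimeLimit]
        exact ENNReal.ofReal_le_ofReal (hlim n t ht.2 u)
      refine (mul_le_mul_right hsup _).trans ?_
      rw [← ENNReal.ofReal_mul (by positivity)]
      refine ENNReal.ofReal_le_ofReal ?_
      rw [mul_left_comm, ← Real.rpow_add (by norm_num), add_neg_cancel, Real.rpow_zero]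
      linarith
  · intro p hp
    refine VovkLocalTime.forTypicalPaths_localGain_le.mono fun S hS => ?_
    obtain ⟨B, hB, hS⟩ := hS
    obtain ⟨R, hR⟩ := VovkLocalTime.exists_abs_le S T
    obtain ⟨D, hD⟩ := VovkLocalTime.exists_pVariation_le hR hB hS hp
    refine lt_of_le_of_lt (iSup_le fun n => iSup₂_le fun t ht => hD n t ht.2) ?_
    exact ENNReal.rpow_lt_top_of_nonneg (by positivity) ENNReal.ofReal_ne_top
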